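/- Let $n\ge 1$ be an integer, $0<p\le n$ real, and let $X_n=(d_{jk}w_{jk})_{j,k=1}^n$, where the $w_{jk}$ are i.i.d. complex random variables with finite fourth moment and $$\mathbf E\,w_{jk}=\mathbf E\,w_{jk}^2=0,\qquad \mathbf E|w_{jk}|^2=1,\qquad \mathbf E\,|w_{jk}|^2w_{jk}=0,\qquad \mathbf E|w_{jk}|^4=2$$ (for example, standard complex Gaussian variables), and the $d_{jk}$ are i.i.d., independent of the family $\{w_{jk}\}$, equal to $1/\sqrt p$ with probability $p/n$ and to $0$ with probability $1-p/n$. For $z_1,z_2\in\mathbb C$ let $$\mathsf f_2(z_1,z_2)=\mathbf E\Big\{\prod_{s=1}^{2}\det(X_n-z_s)\det(X_n-z_s)^*\Big\}$$ be the second correlation function of the characteristic polynomials. Put $b=\sqrt{\frac{2(n-p)}{np}}$, $Z=\operatorname{diag}(z_1,z_2)$ and, for $Q\in M_2(\mathbb C)$ and $v\in\mathbb C$, $$A(Q)=\begin{pmatrix}-Z&Q\\-Q^*&-Z^*\end{pmatrix},\qquad h(Q,v)=\det A(Q)+bv\det Q^*+b\bar v\det Q+b^2|v|^2,$$ $$\hat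 f(Q,v)=-\operatorname{tr}Q^*Q-|v|^2+\log h(Q,v)$$ (here $h$ is complex valued; the choice of the branch of the logarithm does not affect $e^{n\hat f}$, and $\hat f$ is defined off the Lebesgue-null set $\{h=0\}$). Then the expectation defining $\mathsf f_2(z_1,z_2)$ and the integral below converge absolutely, and $$\mathsf f_2(z_1,z_2)=\Big(\frac n\pi\Big)^5\int_{M_2(\mathbb C)\times\mathbb C}e^{n\hat f(Q,v)}\,dQ\,d\bar v\,dv,$$ where $dQ=\prod_{j,k=1}^2d\bar Q_{jk}\,dQ_{jk}$ and, for a complex variable $u=x+iy$, $d\bar u\,du=dx\,dy$ denotes Lebesgue measure on $\mathbb C$. -/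

import Mathlib

open MeasureTheory ProbabilityTheory
open scoped Matrix

noncomputable section

namespace SparseCharPoly

/-- The sparse `n × n` complex random matrix model: real random variables `d j k` and complex
random variables `w j k` on the probability space `(Ω, μ)`, the matrix entries being
`d j k * w j k`.
* The `w j k` are i.i.d. with finite fourth moment, `E w = E w² = 0`, `E |w|² = 1`, and their
  remaining mixed moments of order three and four are those of a standard complex Gaussian,
  `E |w|² w = 0` and `E |w|⁴ = 2`; the standard complex Gaussian itself is an example.
* The `d j k` are i.i.d., equal to `1 / √p` with probability `p / n` and to `0` with probability
  `1 - p / n`.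
* The family `d` is independent of the family `w`. -/
structure IsSparseEnsemble {Ω : Type*} [MeasurableSpace Ω] (μ : Measure Ω) (n : ℕ) (p : ℝ)
    (d : Fin n → Fin n → Ω → ℝ) (w : Fin n → Fin n → Ω → ℂ) : Prop where
  measurable_d : ∀ j k, Measurable (d j k)
  measurable_w : ∀ j k, Measurable (w j k)
  indep_d : iIndepFun (fun (e : Fin n × Fin n) (ω : Ω) => d e.1 e.2 ω) μ
  indep_w : iIndepFun (fun (e : Fin n × Fin n) (ω : Ω) => w e.1 e.2 ω) μ
  indep_d_w : IndepFun (fun (ω : Ω) (e : Fin n × Fin n) => d e.1 e.2 ω)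
    (fun (ω : Ω) (e : Fin n × Fin n) => w e.1 e.2 ω) μ
  identDistrib_w : ∀ j k j' k', IdentDistrib (w j k) (w j' k') μ μ
  prob_d_one : ∀ j k, μ.real {ω | d j k ω = 1 / √p} = p / n
  prob_d_zero : ∀ j k, μ.real {ω | d j k ω = 0} = 1 - p / n
  memLp_w : ∀ j k, MemLp (w j k) 4 μ
  mean_w : ∀ j k, ∫ ω, w j k ω ∂μ = 0
  mean_w_sq : ∀ j k, ∫ ω, (w j k ω) ^ 2 ∂μ = 0
  mean_norm_w_sq : ∀ j k, ∫ ω, ‖w j k ω‖ ^ 2 ∂μ = 1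
  mean_norm_w_sq_mul_w : ∀ j k, ∫ ω, ((‖w j k ω‖ ^ 2 : ℝ) : ℂ) * w j k ω ∂μ = 0
  mean_norm_w_fourth : ∀ j k, ∫ ω, ‖w j k ω‖ ^ 4 ∂μ = 2

/-- The random matrix `X_n = (d_{jk} w_{jk})`. -/
def sparseMatrix {Ω : Type*} {n : ℕ} (d : Fin n → Fin n → Ω → ℝ) (w : Fin n → Fin n → Ω → ℂ)
    (ω : Ω) : Matrix (Fin n) (Fin n) ℂ :=
  Matrix.of fun j k => (d j k ω : ℂ) * w j k ω

/-- The product `∏ₛ det (H - zₛ) det (H - zₛ)*`. -/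
def charPolyProd {n m : ℕ} (H : Matrix (Fin n) (Fin n) ℂ) (z : Fin m → ℂ) : ℂ :=
  ∏ s, (H - z s • (1 : Matrix (Fin n) (Fin n) ℂ)).det *
    ((H - z s • (1 : Matrix (Fin n) (Fin n) ℂ))ᴴ).det

/-- The `m`-th correlation function of the characteristic polynomials of the random matrix `H`. -/
def corrFun {Ω : Type*} [MeasurableSpace Ω] (μ : Measure Ω) {n m : ℕ}
    (H : Ω → Matrix (Fin n) (Fin n) ℂ) (z : Fin m → ℂ) : ℂ :=
  ∫ ω, charPolyProd (H ω) z ∂μ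

/-- `b = √(2 (n - p) / (n p))`. -/
def bParam (n : ℕ) (p : ℝ) : ℝ := √(2 * ((n : ℝ) - p) / ((n : ℝ) * p))

/-- The `4 × 4` block matrix `A(Q)` with blocks `-Z`, `Q`, `-Q*`, `-Z*`, `Z = diag (z₁, z₂)`. -/
def blockA (z₁ z₂ : ℂ) (Q : Matrix (Fin 2) (Fin 2) ℂ) :
    Matrix (Fin 2 ⊕ Fin 2) (Fin 2 ⊕ Fin 2) ℂ :=
  Matrix.fromBlocks (-Matrix.diagonal ![z₁, z₂]) Q (-Qᴴ) (-(Matrix.diagonal ![z₁, z₂])ᴴ)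

/-- `h(Q,v) = det A + b v det Q* + b v̄ det Q + b² |v|²` (a complex number in general). -/
def hFun (b : ℝ) (z₁ z₂ : ℂ) (Q : Matrix (Fin 2) (Fin 2) ℂ) (v : ℂ) : ℂ :=
  (blockA z₁ z₂ Q).det + (b : ℂ) * v * (Qᴴ).det + (b : ℂ) * star v * Q.det
    + (b : ℂ) ^ 2 * ((‖v‖ ^ 2 : ℝ) : ℂ)

/-- `f̂(Q,v) = - tr Q*Q - |v|² + log h(Q,v)`, with the principal branch of the logarithm.
The branch does not affect `exp (n f̂)` for a natural number `n`. -/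
def fHat (b : ℝ) (z₁ z₂ : ℂ) (Q : Matrix (Fin 2) (Fin 2) ℂ) (v : ℂ) : ℂ :=
  -(Qᴴ * Q).trace - ((‖v‖ ^ 2 : ℝ) : ℂ) + Complex.log (hFun b z₁ z₂ Q v)

end SparseCharPoly

end

/-!
# The second correlation function as an integral over `M₂(ℂ) × ℂ`

The proof is the supersymmetric one: linearize the determinants with Grassmann variables, average
over the matrix, and linearize the resulting quartic terms with Gaussian variables `Q` and `v`.

**Grassmann side.** Four anticommuting generators are attached to each site `k < n`, one for each
of the four determinants. The product of the determinants is the Berezin integral of a product over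
the rows `j` of products of four vectors, the coordinates of which are entries of the row `j`
(`berezin_prod_gquad_rowVec`, `prod_det_eq_sum`). Products of two vectors are central, so that all
the later computations take place in a commutative ring.

**Average.** Each row contains an entry at most twice and its conjugate at most twice. Of the
moments of these orders only `E |x|² = 1 / n` and `E |x|⁴ = 2 / n² + b² / n` are not zero, so the
entries behave like Gaussian ones with an additional fourth cumulant `b² / n`. The mean of the row
`j` (`rowMean`, `integral_row`) is therefore a polynomial `rowPoly` in the variables of the site
`j`, evaluated at the four sums `S_st` over the sites of products of two generators and at the sum
`T` of the products of four (`eval_rowPoly_dualVec`, `corrFun_eq_berezin`).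

**Gaussian side.** The Gaussian weight reproduces polynomials: integrating `P (q)` against
`exp (∑ conj (q i) * α i)` evaluates `P` at `α / n`, also for nilpotent `α` (`reproducing`). With
`α` made of the sums `S_st` and `-b T`, this exponential is a product over the sites as well, since
each summand has square zero (`prod_truncExp_dualVec`). For given `(Q, v)` the whole integrand is
now a product over the sites of the same even element, and its Berezin integral is the `n`-th power
of `h(Q, v)` (`berezin_dual`, `hFun_eq_dualTop`).

Replacing `h ^ n` by `exp (n log h)` requires `h ≠ 0`, which holds almost everywhere
(`ae_hFun_ne_zero`).
-/

noncomputable section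

namespace SparseCharPoly

variable {n : ℕ}

/-! ### The Grassmann algebra and its centre -/

/-- The Grassmann algebra with four anticommuting generators at each of `n` sites. -/
abbrev Grassmann (n : ℕ) : Type := ExteriorAlgebra ℂ (Fin n × Fin 4 → ℂ)

/-- The centre of the Grassmann algebra: a commutative ring containing every even element. -/
def GrassmannCenter (n : ℕ) : Type := Subalgebra.center ℂ (Grassmann n)

instance : CommRing (GrassmannCenter n) :=
  inferInstanceAs (CommRing (Subalgebra.center ℂ (Grassmann n)))

instance : Algebra ℂ (GrassmannCenter n) :=
  inferInstanceAs (Algebra ℂ (Subalgebra.center ℂ (Grassmann n)))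

/-- The inclusion of the centre into the Grassmann algebra. -/
def centerVal (n : ℕ) : GrassmannCenter n →ₐ[ℂ] Grassmann n :=
  (Subalgebra.center ℂ (Grassmann n)).val

lemma centerVal_injective : Function.Injective (centerVal n) := Subtype.val_injective

/-- The inclusion of the vectors into the Grassmann algebra. -/
abbrev gvec (v : Fin n × Fin 4 → ℂ) : Grassmann n := ExteriorAlgebra.ι ℂ v

/-- The vector of the generator number `s` at the site `k`. -/
def genVec (k : Fin n) (s : Fin 4) : Fin n × Fin 4 → ℂ := Pi.single (k, s) 1

lemma gvec_mul_swap (x y : Fin n × Fin 4 → ℂ) : gvec x * gvec y = -(gvec y * gvec x) :=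
  eq_neg_of_add_eq_zero_left (ExteriorAlgebra.ι_add_mul_swap x y)

lemma gvec_mul_gvec_mem_center (x y : Fin n × Fin 4 → ℂ) :
    gvec x * gvec y ∈ Subalgebra.center ℂ (Grassmann n) := by
  rw [Subalgebra.mem_center_iff]
  intro b
  induction b using ExteriorAlgebra.induction with
  | algebraMap r => exact Algebra.commutes _ _
  | ι v =>
    change gvec v * (gvec x * gvec y) = gvec x * gvec y * gvec v
    rw [← mul_assoc, gvec_mul_swap v x, neg_mul, mul_assoc, gvec_mul_swap v y, mul_neg, neg_neg,
      mul_assoc]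
  | mul a b ha hb => rw [mul_assoc, hb, ← mul_assoc, ha, mul_assoc]
  | add a b ha hb => rw [add_mul, mul_add, ha, hb]

/-- The product of two vectors, as an element of the centre. -/
def gpair (x y : Fin n × Fin 4 → ℂ) : GrassmannCenter n :=
  ⟨gvec x * gvec y, gvec_mul_gvec_mem_center x y⟩

@[simp] lemma centerVal_gpair (x y : Fin n × Fin 4 → ℂ) :
    centerVal n (gpair x y) = gvec x * gvec y := rfl

lemma gpair_swap (x y : Fin n × Fin 4 → ℂ) : gpair x y = -gpair y x :=
  centerVal_injective (by simpa using gvec_mul_swap x y)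

/-- Exchanging the inner vectors of a product of four costs a sign. -/
lemma gpair_mul_gpair_swap (x y u v : Fin n × Fin 4 → ℂ) :
    gpair x y * gpair u v = -(gpair x u * gpair y v) := by
  apply centerVal_injective
  simp only [map_mul, map_neg, centerVal_gpair]
  rw [mul_assoc, ← mul_assoc (gvec y), gvec_mul_swap y u]
  simp only [neg_mul, mul_neg, mul_assoc]

lemma gpair_self (x : Fin n × Fin 4 → ℂ) : gpair x x = 0 :=
  centerVal_injective (by simp)

/-- Pairs that share their first vector have product zero. -/
lemma gpair_mul_gpair_left (x y v : Fin n × Fin 4 → ℂ) : gpair x y * gpair x v = 0 := by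
  rw [gpair_mul_gpair_swap, gpair_self, zero_mul, neg_zero]

/-- Pairs that share their second vector have product zero. -/
lemma gpair_mul_gpair_right (x y u : Fin n × Fin 4 → ℂ) : gpair x y * gpair u y = 0 := by
  rw [gpair_swap x y, gpair_swap u y, neg_mul_neg, gpair_mul_gpair_left]

/-! ### The Berezin integral -/

/-- The Berezin integral: the coefficient of the product of all generators, taken site by site.
It is the determinant on products of `n * 4` vectors and zero on products of any other length. -/
def berezin (n : ℕ) : Grassmann n →ₗ[ℂ] ℂ :=
  ExteriorAlgebra.liftAlternating fun i =>
    if h : n * 4 = i then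
      (Matrix.detRowAlternating (n := Fin n × Fin 4) (R := ℂ)).domDomCongr
        (finProdFinEquiv.trans (finCongr h))
    else 0

/-- Only the products of exactly `n * 4` vectors contribute to the Berezin integral. -/
lemma berezin_list_prod (l : List (Fin n × Fin 4 → ℂ)) (hl : l.length ≠ n * 4) :
    berezin n (l.map gvec).prod = 0 := by
  have h : (l.map gvec).prod = ExteriorAlgebra.ιMulti ℂ l.length l.get := by
    rw [ExteriorAlgebra.ιMulti_apply]
    congr 1
    conv_lhs => rw [← List.ofFn_get l, List.map_ofFn]
    rfl
  rw [h, berezin, ExteriorAlgebra.liftAlternating_apply_ιMulti, dif_neg (Ne.symm hl)]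
  rfl

/-- The product of four vectors, as an element of the centre. -/
def gquad (a : Fin 4 → Fin n × Fin 4 → ℂ) : GrassmannCenter n :=
  gpair (a 0) (a 1) * gpair (a 2) (a 3)

/-- The Berezin integral of a product of `n` products of four vectors is a determinant. -/
lemma berezin_prod_gquad (a : Fin n → Fin 4 → Fin n × Fin 4 → ℂ) :
    berezin n (centerVal n (∏ j, gquad (a j))) =
      (Matrix.of fun q : Fin n × Fin 4 => a q.1 q.2).det := by
  have h : (centerVal n (∏ j, gquad (a j))) =
      ExteriorAlgebra.ιMulti ℂ (n * 4)
        (fun i => a (finProdFinEquiv.symm i).1 (finProdFinEquiv.symm i).2) := by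
    rw [ExteriorAlgebra.ιMulti_apply, List.ofFn_mul, List.prod_flatten, List.map_ofFn,
      ← List.prod_ofFn]
    rw [map_list_prod, List.map_ofFn]
    congr 2
    funext j
    have e : ∀ s : Fin 4, finProdFinEquiv.symm (⟨j * 4 + s, by
        have := j.2; have := s.2; omega⟩ : Fin (n * 4)) = (j, s) := by
      intro s
      rw [Equiv.symm_apply_eq]
      ext
      simp [finProdFinEquiv]
      ring
    simp only [Function.comp_apply, e]
    simp [gquad, List.ofFn_succ, mul_assoc]
  rw [h, berezin, ExteriorAlgebra.liftAlternating_apply_ιMulti, dif_pos rfl]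
  rw [AlternatingMap.domDomCongr_apply]
  change Matrix.det _ = _
  congr 1
  ext q r
  change a (finProdFinEquiv.symm (finProdFinEquiv q)).1 (finProdFinEquiv.symm (finProdFinEquiv q)).2 r = _
  rw [Equiv.symm_apply_apply, Matrix.of_apply]

/-- The elements of degree at most `m` of the Grassmann algebra. -/
def degLE (n m : ℕ) : Submodule ℂ (Grassmann n) :=
  Submodule.span ℂ {x | ∃ l : List (Fin n × Fin 4 → ℂ), l.length ≤ m ∧ x = (l.map gvec).prod}

lemma mul_mem_degLE {a b : ℕ} {x y : Grassmann n} (hx : x ∈ degLE n a) (hy : y ∈ degLE n b) :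
    x * y ∈ degLE n (a + b) := by
  have := Submodule.mul_mem_mul hx hy
  rw [degLE, degLE, Submodule.span_mul_span] at this
  refine Submodule.span_mono ?_ this
  rintro _ ⟨_, ⟨l, hl, rfl⟩, _, ⟨l', hl', rfl⟩, rfl⟩
  exact ⟨l ++ l', by simp; omega, by simp⟩

lemma degLE_mono {a b : ℕ} (h : a ≤ b) : degLE n a ≤ degLE n b :=
  Submodule.span_mono fun _ ⟨l, hl, hx⟩ => ⟨l, hl.trans h, hx⟩

lemma one_mem_degLE (m : ℕ) : (1 : Grassmann n) ∈ degLE n m :=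
  Submodule.subset_span ⟨[], by simp, by simp⟩

lemma gpair_mem_degLE (x y : Fin n × Fin 4 → ℂ) : centerVal n (gpair x y) ∈ degLE n 2 :=
  Submodule.subset_span ⟨[x, y], by simp, by simp⟩

lemma prod_mem_degLE {ι : Type*} (s : Finset ι) (x : ι → GrassmannCenter n) (m : ℕ)
    (hx : ∀ k ∈ s, centerVal n (x k) ∈ degLE n m) :
    (centerVal n (∏ k ∈ s, x k)) ∈ degLE n (s.card * m) := by
  classical
  induction s using Finset.induction_on with
  | empty => simpa using one_mem_degLE _
  | insert k s hk ih =>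
    rw [Finset.prod_insert hk, Finset.card_insert_of_notMem hk, add_mul, one_mul, add_comm, map_mul]
    exact mul_mem_degLE (hx k (by simp)) (ih fun j hj => hx j (by simp [hj]))

lemma berezin_eq_zero_of_mem_degLE {m : ℕ} (hm : m < n * 4) {x : Grassmann n}
    (hx : x ∈ degLE n m) : berezin n x = 0 := by
  induction hx using Submodule.span_induction with
  | mem x h => obtain ⟨l, hl, rfl⟩ := h; exact berezin_list_prod l (by omega)
  | zero => simp
  | add x y _ _ hx hy => rw [map_add, hx, hy, add_zero]
  | smul c x _ hx => rw [map_smul, hx, smul_zero]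

/-! ### The even elements of one site -/

/-- The product of the generators `s` and `2 + t` at the site `k`. -/
def sitePair (k : Fin n) (s t : Fin 2) : GrassmannCenter n :=
  gpair (genVec k (![0, 1] s)) (genVec k (![2, 3] t))

/-- The product of the four generators at the site `k`. -/
def siteTop (k : Fin n) : GrassmannCenter n := gquad (genVec k)

lemma sitePair_mul_sitePair (k : Fin n) (s t s' t' : Fin 2) :
    sitePair k s t * sitePair k s' t' =
      if s = s' ∨ t = t' then 0 else if s = t then -siteTop k else siteTop k := by
  have h1 : sitePair k 0 0 * sitePair k 1 1 = -siteTop k := by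
    simp only [sitePair, siteTop, gquad, Matrix.cons_val_zero, Matrix.cons_val_one]
    rw [gpair_mul_gpair_swap]
  have h2 : sitePair k 0 1 * sitePair k 1 0 = siteTop k := by
    simp only [sitePair, siteTop, gquad, Matrix.cons_val_zero, Matrix.cons_val_one]
    rw [gpair_mul_gpair_swap, gpair_swap (genVec k 3) (genVec k 2), mul_neg, neg_neg]
  fin_cases s <;> fin_cases t <;> fin_cases s' <;> fin_cases t' <;>
    simp [h1, h2, mul_comm (sitePair k 1 1), mul_comm (sitePair k 1 0) (sitePair k 0 1)] <;>
    simp [sitePair, gpair_mul_gpair_left, gpair_mul_gpair_right]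

lemma sitePair_mul_siteTop (k : Fin n) (s t : Fin 2) : sitePair k s t * siteTop k = 0 := by
  have h : siteTop k = sitePair k s (t + 1) * sitePair k (s + 1) t ∨
      siteTop k = -(sitePair k s (t + 1) * sitePair k (s + 1) t) := by
    rw [sitePair_mul_sitePair]
    fin_cases s <;> fin_cases t <;> simp
  have h0 : sitePair k s t * (sitePair k s (t + 1) * sitePair k (s + 1) t) = 0 := by
    rw [← mul_assoc, sitePair_mul_sitePair, if_pos (Or.inl rfl), zero_mul]
  rcases h with h | h <;> rw [h] <;> simp [h0]

lemma siteTop_mul_self (k : Fin n) : siteTop k * siteTop k = 0 := by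
  have h : siteTop k = sitePair k 0 1 * sitePair k 1 0 := by simp [sitePair_mul_sitePair]
  nth_rewrite 1 [h]
  rw [mul_assoc, sitePair_mul_siteTop, mul_zero]

/-- The general even element of the site `k`. -/
def siteElt (k : Fin n) (α : ℂ) (β : Fin 2 → Fin 2 → ℂ) (γ : ℂ) : GrassmannCenter n :=
  algebraMap ℂ _ α + ∑ s, ∑ t, β s t • sitePair k s t + γ • siteTop k

/-- The multiplication of the even elements of a site: it polarizes the determinant. -/
lemma siteElt_mul (k : Fin n) (α α' γ γ' : ℂ) (β β' : Fin 2 → Fin 2 → ℂ) :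
    siteElt k α β γ * siteElt k α' β' γ' =
      siteElt k (α * α') (fun s t => α * β' s t + α' * β s t)
        (α * γ' + α' * γ - β 0 0 * β' 1 1 - β 1 1 * β' 0 0 + β 0 1 * β' 1 0 + β 1 0 * β' 0 1) := by
  have e1 : ∀ s t s' t', _ := sitePair_mul_sitePair k
  have e2 := sitePair_mul_siteTop k
  have e3 : ∀ s t, siteTop k * sitePair k s t = 0 := fun s t => by rw [mul_comm, e2]
  have e4 := siteTop_mul_self k
  simp only [siteElt, Fin.sum_univ_two, Algebra.algebraMap_eq_smul_one, mul_add, add_mul,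
    smul_mul_smul_comm, e1, e2, e3, e4, one_mul, mul_one]
  simp
  module

lemma berezin_prod_siteTop : berezin n (centerVal n (∏ k, siteTop k)) = 1 := by
  simp only [siteTop]
  rw [berezin_prod_gquad]
  convert Matrix.det_one (n := Fin n × Fin 4) (R := ℂ)
  ext q r
  simp [genVec, Matrix.one_apply, Pi.single_apply, eq_comm]

/-- The Berezin integral factorizes over the sites. -/
lemma berezin_prod_siteElt (α : Fin n → ℂ) (β : Fin n → Fin 2 → Fin 2 → ℂ) (γ : Fin n → ℂ) :
    berezin n (centerVal n (∏ k, siteElt k (α k) (β k) (γ k))) = ∏ k, γ k := by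
  classical
  obtain ⟨low, hlow, hsplit⟩ : ∃ low : Fin n → GrassmannCenter n,
      (∀ k, centerVal n (low k) ∈ degLE n 2) ∧
        ∀ k, siteElt k (α k) (β k) (γ k) = γ k • siteTop k + low k := by
    refine ⟨fun k => algebraMap ℂ _ (α k) + ∑ s, ∑ t, β k s t • sitePair k s t, fun k => ?_,
      fun k => add_comm _ _⟩
    rw [map_add, Algebra.algebraMap_eq_smul_one, map_smul, map_one, map_sum]
    refine add_mem (Submodule.smul_mem _ _ (one_mem_degLE _)) (sum_mem fun s _ => ?_)
    rw [map_sum]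
    refine sum_mem fun t _ => ?_
    rw [map_smul]
    exact Submodule.smul_mem _ _ (gpair_mem_degLE _ _)
  have htop : ∀ k, centerVal n (γ k • siteTop k) ∈ degLE n 4 := by
    intro k
    rw [map_smul, siteTop, gquad, map_mul]
    exact Submodule.smul_mem _ _ (degLE_mono (by norm_num)
      (mul_mem_degLE (gpair_mem_degLE _ _) (gpair_mem_degLE _ _)))
  simp only [hsplit]
  rw [Finset.prod_add, map_sum (centerVal n), map_sum (berezin n),
    Finset.sum_eq_single Finset.univ]
  · have : ∏ k, γ k • siteTop k = (∏ k, γ k) • ∏ k, siteTop k := by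
      simp only [Algebra.smul_def, Finset.prod_mul_distrib, map_prod]
    simp [this, berezin_prod_siteTop]
  · -- a term in which some site does not contribute its top element has too low a degree
    intro t _ ht
    have hc : t.card < n := by
      simpa using Finset.card_lt_card (Finset.ssubset_univ_iff.mpr ht)
    rw [map_mul]
    refine berezin_eq_zero_of_mem_degLE ?_ (mul_mem_degLE
      (prod_mem_degLE t _ 4 fun k _ => htop k) (prod_mem_degLE _ _ 2 fun k _ => hlow k))
    rw [Finset.card_sdiff_of_subset (Finset.subset_univ t), Finset.card_univ, Fintype.card_fin]
    omega
  · simp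

/-! ### Determinants as Berezin integrals -/

lemma centerVal_gquad (a : Fin 4 → Fin n × Fin 4 → ℂ) :
    centerVal n (gquad a) = ExteriorAlgebra.ιMulti ℂ 4 a := by
  simp [gquad, ExteriorAlgebra.ιMulti_apply, mul_assoc]
  rfl

/-- The vector with coordinates `u` with respect to the generators number `s`. -/
def rowVec (s : Fin 4) (u : Fin n → ℂ) : Fin n × Fin 4 → ℂ :=
  fun q => if q.2 = s then u q.1 else 0

lemma rowVec_eq_sum (s : Fin 4) (u : Fin n → ℂ) : rowVec s u = ∑ k, u k • genVec k s := by
  ext ⟨k, t⟩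
  by_cases h : t = s <;> simp [rowVec, genVec, Pi.single_apply, h]

/-- The product of the generators `0, 1, 2, 3` taken at the sites `κ 0, κ 1, κ 2, κ 3`. -/
def genQuad (κ : Fin 4 → Fin n) : GrassmannCenter n := gquad fun s => genVec (κ s) s

/-- Multilinear expansion of the product of the four vectors of a row. -/
lemma gquad_rowVec (u : Fin 4 → Fin n → ℂ) :
    gquad (fun s => rowVec s (u s)) = ∑ κ : Fin 4 → Fin n, (∏ s, u s (κ s)) • genQuad κ := by
  apply centerVal_injective
  rw [map_sum (centerVal n), centerVal_gquad]
  simp only [rowVec_eq_sum]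
  change (ExteriorAlgebra.ιMulti ℂ 4).toMultilinearMap _ = _
  rw [MultilinearMap.map_sum]
  refine Finset.sum_congr rfl fun κ _ => ?_
  rw [MultilinearMap.map_smul_univ, map_smul, genQuad, centerVal_gquad]
  rfl

lemma berezin_prod_gquad_rowVec (M : Fin 4 → Matrix (Fin n) (Fin n) ℂ) :
    berezin n (centerVal n (∏ j, gquad fun s => rowVec s fun k => M s j k)) = ∏ s, (M s).det := by
  rw [berezin_prod_gquad, ← Matrix.det_blockDiagonal]
  congr 1
  ext ⟨j, s⟩ ⟨k, t⟩
  simp [rowVec, Matrix.blockDiagonal_apply, eq_comm]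

lemma berezin_prod_sum_smul_genQuad (c : Fin n → (Fin 4 → Fin n) → ℂ) :
    berezin n (centerVal n (∏ j, ∑ κ, c j κ • genQuad κ)) =
      ∑ K : Fin n → Fin 4 → Fin n,
        (∏ j, c j (K j)) * berezin n (centerVal n (∏ j, genQuad (K j))) := by
  rw [Finset.prod_univ_sum, Fintype.piFinset_univ, map_sum (centerVal n), map_sum (berezin n)]
  refine Finset.sum_congr rfl fun K _ => ?_
  have : ∏ j, c j (K j) • genQuad (K j) = (∏ j, c j (K j)) • ∏ j, genQuad (K j) := by
    simp only [Algebra.smul_def, Finset.prod_mul_distrib, map_prod]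
  rw [this, map_smul, map_smul, smul_eq_mul]

/-- A product of four determinants, as a polynomial in the entries of the four matrices. -/
lemma prod_det_eq_sum (M : Fin 4 → Matrix (Fin n) (Fin n) ℂ) :
    ∏ s, (M s).det = ∑ K : Fin n → Fin 4 → Fin n,
      (∏ j, ∏ s, M s j (K j s)) * berezin n (centerVal n (∏ j, genQuad (K j))) := by
  rw [← berezin_prod_gquad_rowVec, ← berezin_prod_sum_smul_genQuad fun j κ => ∏ s, M s j (κ s)]
  simp only [gquad_rowVec]

/-! ### The averaged rows -/

lemma genQuad_eq (k l m r : Fin n) :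
    genQuad ![k, l, m, r] =
      gpair (genVec k 0) (genVec l 1) * gpair (genVec m 2) (genVec r 3) := rfl

lemma genQuad_straight (k l : Fin n) :
    genQuad ![k, l, k, l] = -(sitePair k 0 0 * sitePair l 1 1) := by
  rw [genQuad_eq, gpair_mul_gpair_swap]; rfl

lemma genQuad_cross (k l : Fin n) :
    genQuad ![k, l, l, k] = sitePair k 0 1 * sitePair l 1 0 := by
  rw [genQuad_eq, gpair_swap (genVec l 2), mul_neg, gpair_mul_gpair_swap, neg_neg]; rfl

lemma genQuad_diag (k : Fin n) : genQuad ![k, k, k, k] = siteTop k := rfl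

/-- The sum over the sites of the products of two generators. -/
def pairSum (n : ℕ) (s t : Fin 2) : GrassmannCenter n := ∑ k, sitePair k s t

/-- The sum over the sites of the products of all four generators. -/
def topSum (n : ℕ) : GrassmannCenter n := ∑ k, siteTop k

/-- The mean of `∏ s, (y s (κ s) + ζ s δ_{κ s, j})` over a row whose first two copies `y 0 = y 1`
are the entries and whose last two copies `y 2 = y 3` are their conjugates; `σ` is the second
absolute moment of an entry and `τ` its fourth cumulant. -/
def rowMean (σ τ : ℂ) (ζ : Fin 4 → ℂ) (j : Fin n) (κ : Fin 4 → Fin n) : ℂ :=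
  ζ 0 * ζ 1 * ζ 2 * ζ 3 * (if κ = ![j, j, j, j] then 1 else 0)
    + σ * ζ 1 * ζ 3 * ∑ k, (if κ = ![k, j, k, j] then 1 else 0)
    + σ * ζ 1 * ζ 2 * ∑ k, (if κ = ![k, j, j, k] then 1 else 0)
    + σ * ζ 0 * ζ 3 * ∑ k, (if κ = ![j, k, k, j] then 1 else 0)
    + σ * ζ 0 * ζ 2 * ∑ k, (if κ = ![j, k, j, k] then 1 else 0)
    + σ ^ 2 * ∑ k, ∑ l, (if κ = ![k, l, k, l] then 1 else 0)
    + σ ^ 2 * ∑ k, ∑ l, (if κ = ![k, l, l, k] then 1 else 0)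
    + τ * ∑ k, (if κ = ![k, k, k, k] then 1 else 0)

lemma sum_rowMean_smul_genQuad (σ τ : ℂ) (ζ : Fin 4 → ℂ) (j : Fin n) :
    ∑ κ, rowMean σ τ ζ j κ • genQuad κ =
      (ζ 0 * ζ 1 * ζ 2 * ζ 3) • siteTop j
        - (σ * ζ 1 * ζ 3) • (pairSum n 0 0 * sitePair j 1 1)
        + (σ * ζ 1 * ζ 2) • (pairSum n 0 1 * sitePair j 1 0)
        + (σ * ζ 0 * ζ 3) • (pairSum n 1 0 * sitePair j 0 1)
        - (σ * ζ 0 * ζ 2) • (pairSum n 1 1 * sitePair j 0 0)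
        - σ ^ 2 • (pairSum n 0 0 * pairSum n 1 1)
        + σ ^ 2 • (pairSum n 0 1 * pairSum n 1 0)
        + τ • topSum n := by
  have h1 : ∀ a : Fin 4 → Fin n,
      ∑ κ, (if κ = a then (1 : ℂ) else 0) • genQuad κ = genQuad a := by
    intro a; simp [ite_smul]
  have h2 : ∀ a : Fin n → Fin 4 → Fin n,
      ∑ κ, (∑ k, if κ = a k then (1 : ℂ) else 0) • genQuad κ = ∑ k, genQuad (a k) := by
    intro a
    simp only [Finset.sum_smul]
    rw [Finset.sum_comm]
    simp only [h1]
  have h3 : ∀ a : Fin n → Fin n → Fin 4 → Fin n,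
      ∑ κ, (∑ k, ∑ l, if κ = a k l then (1 : ℂ) else 0) • genQuad κ =
        ∑ k, ∑ l, genQuad (a k l) := by
    intro a
    simp only [Finset.sum_smul]
    rw [Finset.sum_comm]
    refine Finset.sum_congr rfl fun k _ => ?_
    rw [Finset.sum_comm]
    simp only [h1]
  have e1 : ∑ k, genQuad ![k, j, k, j] = -(pairSum n 0 0 * sitePair j 1 1) := by
    simp only [pairSum, Finset.sum_mul, ← Finset.sum_neg_distrib, genQuad_straight]
  have e2 : ∑ k, genQuad ![k, j, j, k] = pairSum n 0 1 * sitePair j 1 0 := by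
    simp only [pairSum, Finset.sum_mul, genQuad_cross]
  have e3 : ∑ k, genQuad ![j, k, k, j] = pairSum n 1 0 * sitePair j 0 1 := by
    simp only [mul_comm _ (sitePair j 0 1), pairSum, Finset.mul_sum, genQuad_cross]
  have e4 : ∑ k, genQuad ![j, k, j, k] = -(pairSum n 1 1 * sitePair j 0 0) := by
    simp only [mul_comm _ (sitePair j 0 0), pairSum, Finset.mul_sum, ← Finset.sum_neg_distrib,
      genQuad_straight]
  have e5 : ∑ k, ∑ l, genQuad ![k, l, k, l] = -(pairSum n 0 0 * pairSum n 1 1) := by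
    simp only [pairSum, Finset.sum_mul_sum, ← Finset.sum_neg_distrib,
      genQuad_straight]
  have e6 : ∑ k, ∑ l, genQuad ![k, l, l, k] = pairSum n 0 1 * pairSum n 1 0 := by
    simp only [pairSum, Finset.sum_mul_sum, genQuad_cross]
  simp only [rowMean, add_smul, Finset.sum_add_distrib, mul_smul _ (∑ k, _), mul_smul _ (ite _ _ _),
    ← Finset.smul_sum, h1, h2, h3, e1, e2, e3, e4, e5, e6, genQuad_diag, ← topSum.eq_1]
  simp only [smul_neg, ← sub_eq_add_neg]

/-! ### Truncated exponentials of sums of square-zero elements -/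

section TruncatedExp

variable {A : Type*} [CommRing A] [Algebra ℂ A]

/-- The exponential series of `x • a`, truncated after `N` terms. -/
def truncExp (N : ℕ) (x : ℂ) (a : A) : A :=
  ∑ l ∈ Finset.range N, (x ^ l / (l.factorial : ℂ)) • a ^ l

lemma add_pow_succ_of_mul_self_eq_zero (S a : A) (ha : a * a = 0) (l : ℕ) :
    (S + a) ^ (l + 1) = S ^ (l + 1) + ((l : ℂ) + 1) • (S ^ l * a) := by
  induction l with
  | zero => simp
  | succ l ih =>
    rw [pow_succ, ih]
    have h : S ^ l * a * a = 0 := by rw [mul_assoc, ha, mul_zero]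
    simp only [add_mul, mul_add, smul_mul_assoc, h, smul_zero, add_zero]
    rw [mul_right_comm (S ^ l) a S, ← pow_succ, ← pow_succ]
    push_cast
    module

lemma sum_pow_eq_zero_of_mul_self_eq_zero {ι : Type*} (s : Finset ι) (a : ι → A)
    (ha : ∀ k, a k * a k = 0) (l : ℕ) (hl : s.card < l) : (∑ k ∈ s, a k) ^ l = 0 := by
  classical
  induction s using Finset.induction_on generalizing l with
  | empty => simp only [Finset.sum_empty, zero_pow (by simpa using hl.ne' : l ≠ 0)]
  | insert k s hk ih =>
    rw [Finset.card_insert_of_notMem hk] at hl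
    obtain ⟨l, rfl⟩ : ∃ m, l = m + 1 := ⟨l - 1, by omega⟩
    rw [Finset.sum_insert hk, add_comm, add_pow_succ_of_mul_self_eq_zero _ _ (ha k),
      ih l (by omega), ih (l + 1) (by omega)]
    simp

lemma truncExp_add (N : ℕ) (x : ℂ) (S a : A) (ha : a * a = 0) :
    truncExp (N + 1) x (S + a) = truncExp (N + 1) x S + x • a * truncExp N x S := by
  have h : ∀ l ∈ Finset.range N, (x ^ (l + 1) / ((l + 1).factorial : ℂ)) • (S + a) ^ (l + 1) =
      (x ^ (l + 1) / ((l + 1).factorial : ℂ)) • S ^ (l + 1) +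
        x • a * ((x ^ l / (l.factorial : ℂ)) • S ^ l) := by
    intro l _
    rw [add_pow_succ_of_mul_self_eq_zero _ _ ha, smul_add, smul_smul, smul_mul_smul_comm,
      mul_comm a]
    congr 2
    rw [Nat.factorial_succ]
    have h1 : (l.factorial : ℂ) ≠ 0 := by exact_mod_cast l.factorial_ne_zero
    have h2 : (l : ℂ) + 1 ≠ 0 := by exact_mod_cast l.succ_ne_zero
    push_cast
    field_simp
    ring
  simp only [truncExp]
  rw [Finset.sum_range_succ', Finset.sum_congr rfl h, Finset.sum_add_distrib,
    Finset.sum_range_succ' (fun l => (x ^ l / (l.factorial : ℂ)) • S ^ l), Finset.mul_sum]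
  simp only [pow_zero]
  ring

/-- The exponential of a sum of square-zero elements is a product of factors of degree one. -/
lemma prod_one_add_smul {ι : Type*} (s : Finset ι) (a : ι → A) (ha : ∀ k, a k * a k = 0)
    (x : ℂ) (N : ℕ) (hN : s.card < N) :
    ∏ k ∈ s, (1 + x • a k) = truncExp N x (∑ k ∈ s, a k) := by
  classical
  induction s using Finset.induction_on generalizing N with
  | empty =>
    obtain ⟨N, rfl⟩ : ∃ m, N = m + 1 := ⟨N - 1, by simp at hN; omega⟩
    simp [truncExp, Finset.sum_range_succ']
  | insert k s hk ih =>
    rw [Finset.card_insert_of_notMem hk] at hN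
    obtain ⟨N, rfl⟩ : ∃ m, N = m + 1 := ⟨N - 1, by omega⟩
    rw [Finset.sum_insert hk, add_comm (a k), truncExp_add _ _ _ _ (ha k), Finset.prod_insert hk,
      ← ih N (by omega), ← ih (N + 1) (by omega)]
    ring

end TruncatedExp

/-! ### The dual representation of the averaged rows -/

/-- The index set of the five complex integration variables: the entries of `Q`, and `v`. -/
abbrev DualVar : Type := Option (Fin 2 × Fin 2)

/-- The Grassmann elements dual to the integration variables: the sums of pairs for the entries of
`Q`, and `-b` times the sum of the quadruples for `v`. With this sign `b * v` accompanies `det Q`,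
because reordering the generators gives `det Q` a minus sign. -/
def dualVec (n : ℕ) (b : ℂ) : DualVar → GrassmannCenter n
  | some e => pairSum n e.1 e.2
  | none => -b • topSum n

/-- The averaged row number `j`, as a polynomial in the dual variables. -/
def rowPoly (b : ℂ) (ζ : Fin 4 → ℂ) (j : Fin n) : MvPolynomial DualVar (GrassmannCenter n) :=
  MvPolynomial.C ((ζ 0 * ζ 1 * ζ 2 * ζ 3) • siteTop j)
    - MvPolynomial.C ((ζ 1 * ζ 3) • sitePair j 1 1) * MvPolynomial.X (some (0, 0))
    + MvPolynomial.C ((ζ 1 * ζ 2) • sitePair j 1 0) * MvPolynomial.X (some (0, 1))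
    + MvPolynomial.C ((ζ 0 * ζ 3) • sitePair j 0 1) * MvPolynomial.X (some (1, 0))
    - MvPolynomial.C ((ζ 0 * ζ 2) • sitePair j 0 0) * MvPolynomial.X (some (1, 1))
    - MvPolynomial.X (some (0, 0)) * MvPolynomial.X (some (1, 1))
    + MvPolynomial.X (some (0, 1)) * MvPolynomial.X (some (1, 0))
    - MvPolynomial.C (algebraMap ℂ _ b) * MvPolynomial.X none

/-- Evaluated at the dual elements, the row polynomial is the averaged row; the product of the two
coefficients `-b` produces the fourth cumulant `σ * b ^ 2`. -/
lemma eval_rowPoly_dualVec (σ b : ℂ) (ζ : Fin 4 → ℂ) (j : Fin n) :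
    MvPolynomial.eval (fun i => σ • dualVec n b i) (rowPoly b ζ j) =
      ∑ κ, rowMean σ (σ * b ^ 2) ζ j κ • genQuad κ := by
  rw [sum_rowMean_smul_genQuad]
  simp only [rowPoly, map_add, map_sub, map_mul, MvPolynomial.eval_C, MvPolynomial.eval_X, dualVec,
    Algebra.smul_def, map_mul, map_neg, map_pow]
  ring

/-- Evaluated at numbers, the row polynomial is an even element of a single site. -/
lemma eval_rowPoly_algebraMap (b : ℂ) (ζ : Fin 4 → ℂ) (j : Fin n) (q : DualVar → ℂ) :
    MvPolynomial.eval (fun i => algebraMap ℂ _ (q i)) (rowPoly b ζ j) =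
      siteElt j (-(q (some (0, 0)) * q (some (1, 1)) - q (some (0, 1)) * q (some (1, 0)))
          - b * q none)
        ![![-(ζ 0 * ζ 2 * q (some (1, 1))), ζ 0 * ζ 3 * q (some (1, 0))],
          ![ζ 1 * ζ 2 * q (some (0, 1)), -(ζ 1 * ζ 3 * q (some (0, 0)))]]
        (ζ 0 * ζ 1 * ζ 2 * ζ 3) := by
  simp only [rowPoly, map_add, map_sub, map_mul, MvPolynomial.eval_C, MvPolynomial.eval_X, siteElt,
    Fin.sum_univ_two, Matrix.cons_val_zero, Matrix.cons_val_one, Matrix.cons_val_fin_one,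
    Algebra.smul_def, map_mul, map_neg]
  ring

/-- The elements of the site `k` that sum up to the dual Grassmann variables. -/
def siteDual (b : ℂ) (k : Fin n) : DualVar → GrassmannCenter n
  | some e => sitePair k e.1 e.2
  | none => -b • siteTop k

lemma siteDual_mul_self (b : ℂ) (k : Fin n) (i : DualVar) : siteDual b k i * siteDual b k i = 0 := by
  rcases i with _ | ⟨s, t⟩
  · simp [siteDual, siteTop_mul_self]
  · simp [siteDual, sitePair_mul_sitePair]

lemma sum_siteDual (b : ℂ) (i : DualVar) : ∑ k, siteDual b k i = dualVec n b i := by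
  rcases i with _ | ⟨s, t⟩
  · simp only [siteDual, dualVec, topSum, Finset.smul_sum]
  · rfl

lemma dualVec_pow_eq_zero (b : ℂ) (i : DualVar) (l : ℕ) (hl : n < l) : dualVec n b i ^ l = 0 := by
  rw [← sum_siteDual]
  exact sum_pow_eq_zero_of_mul_self_eq_zero _ _ (fun k => siteDual_mul_self b k i) l (by simpa)

lemma prod_one_add_siteDual (b : ℂ) (k : Fin n) (q : DualVar → ℂ) :
    ∏ i, (1 + q i • siteDual b k i) =
      siteElt k 1 (fun s t => q (some (s, t)))
        (-(q (some (0, 0)) * q (some (1, 1)) - q (some (0, 1)) * q (some (1, 0)))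
          - b * q none) := by
  have e00 : ∀ x : ℂ, 1 + x • sitePair k 0 0 = siteElt k 1 ![![x, 0], ![0, 0]] 0 := fun x => by
    simp [siteElt]
  have e01 : ∀ x : ℂ, 1 + x • sitePair k 0 1 = siteElt k 1 ![![0, x], ![0, 0]] 0 := fun x => by
    simp [siteElt]
  have e10 : ∀ x : ℂ, 1 + x • sitePair k 1 0 = siteElt k 1 ![![0, 0], ![x, 0]] 0 := fun x => by
    simp [siteElt]
  have e11 : ∀ x : ℂ, 1 + x • sitePair k 1 1 = siteElt k 1 ![![0, 0], ![0, x]] 0 := fun x => by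
    simp [siteElt]
  have e : ∀ x : ℂ, 1 + x • (-b • siteTop k) = siteElt k 1 ![![0, 0], ![0, 0]] (-(b * x)) :=
    fun x => by simp [siteElt, smul_smul, mul_comm]
  rw [Fintype.prod_option, Fintype.prod_prod_type]
  simp only [Fin.prod_univ_two, siteDual, e00, e01, e10, e11, e, siteElt_mul]
  congr 1
  · simp
  · ext s t
    fin_cases s <;> fin_cases t <;> simp
  · simp
    ring

/-- The exponential of the dual elements factorizes over the sites. -/
lemma prod_truncExp_dualVec (b : ℂ) (q : DualVar → ℂ) :
    ∏ i, truncExp (n + 1) (q i) (dualVec n b i) = ∏ k, ∏ i, (1 + q i • siteDual b k i) := by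
  rw [Finset.prod_comm]
  refine Finset.prod_congr rfl fun i _ => ?_
  rw [prod_one_add_smul _ _ (fun k => siteDual_mul_self b k i) _ (n + 1) (by simp), sum_siteDual]

/-- The polynomial whose `n`-th power is the Berezin integral of the dual representation. It is the
function `h` when `r` is the conjugate of `q`. -/
def dualTop (b : ℂ) (ζ : Fin 4 → ℂ) (q r : DualVar → ℂ) : ℂ :=
  (q (some (0, 0)) * q (some (1, 1)) - q (some (0, 1)) * q (some (1, 0)) + b * q none) *
      (r (some (0, 0)) * r (some (1, 1)) - r (some (0, 1)) * r (some (1, 0)) + b * r none)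
    + ζ 0 * ζ 1 * ζ 2 * ζ 3
    + ζ 1 * ζ 3 * (q (some (0, 0)) * r (some (0, 0)))
    + ζ 1 * ζ 2 * (q (some (0, 1)) * r (some (0, 1)))
    + ζ 0 * ζ 3 * (q (some (1, 0)) * r (some (1, 0)))
    + ζ 0 * ζ 2 * (q (some (1, 1)) * r (some (1, 1)))

/-- For fixed values of the integration variables the rows decouple, and the Berezin integral is
an `n`-th power. -/
lemma berezin_dual (b : ℂ) (ζ : Fin 4 → ℂ) (q r : DualVar → ℂ) :
    berezin n (centerVal n (MvPolynomial.eval (fun i => algebraMap ℂ _ (q i))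
        (∏ j, rowPoly b ζ j) * ∏ i, truncExp (n + 1) (r i) (dualVec n b i))) =
      dualTop b ζ q r ^ n := by
  rw [prod_truncExp_dualVec, map_prod, ← Finset.prod_mul_distrib]
  simp only [eval_rowPoly_algebraMap, prod_one_add_siteDual, siteElt_mul]
  rw [berezin_prod_siteElt, Finset.prod_const, Finset.card_univ, Fintype.card_fin]
  congr 1
  simp [dualTop]
  ring

/-! ### Moments of the complex Gaussian weight -/

/-- The unnormalized Gaussian integrand `q ^ m * conj q ^ l * exp (-N |q|²)` on the plane. -/
def gaussMonomial (N : ℝ) (m l : ℕ) (q : ℂ) : ℂ :=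
  q ^ m * star q ^ l * (Real.exp (-N * ‖q‖ ^ 2) : ℂ)

lemma integral_norm_pow_mul_exp {N : ℝ} (hN : 0 < N) (m : ℕ) :
    ∫ q : ℂ, ‖q‖ ^ m * Real.exp (-N * ‖q‖ ^ 2) =
      Real.pi * N ^ (-((m : ℝ) + 2) / 2) * Real.Gamma (((m : ℝ) + 2) / 2) := by
  have h := Complex.integral_rpow_mul_exp_neg_mul_rpow (p := 2) (q := m) (b := N) (by norm_num)
    (by have : (0 : ℝ) ≤ m := m.cast_nonneg
        linarith) hN
  rw [mul_div_cancel_left₀ Real.pi two_ne_zero] at h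
  simpa only [Real.rpow_natCast, Real.rpow_ofNat] using h

/-- The absolute moment is positive, hence its integrand is integrable. -/
lemma integrable_gaussMonomial {N : ℝ} (hN : 0 < N) (m l : ℕ) :
    Integrable (gaussMonomial N m l) := by
  have h : Integrable fun q : ℂ => ‖q‖ ^ (m + l) * Real.exp (-N * ‖q‖ ^ 2) := by
    apply Integrable.of_integral_ne_zero
    rw [integral_norm_pow_mul_exp hN]
    have : 0 < Real.Gamma ((((m + l : ℕ) : ℝ) + 2) / 2) := Real.Gamma_pos_of_pos (by positivity)
    positivity
  refine h.mono (by unfold gaussMonomial; fun_prop) (Filter.Eventually.of_forall fun q => ?_)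
  simp only [gaussMonomial, pow_add, norm_mul, norm_pow, norm_star, norm_norm, Complex.norm_real]
  exact le_rfl

lemma integral_gaussMonomial_self {N : ℝ} (hN : 0 < N) (m : ℕ) :
    ∫ q, gaussMonomial N m m q = Real.pi / N * ((m.factorial : ℂ) / N ^ m) := by
  have h1 : ∀ q : ℂ, gaussMonomial N m m q =
      ((‖q‖ ^ (2 * m) * Real.exp (-N * ‖q‖ ^ 2) : ℝ) : ℂ) := by
    intro q
    rw [gaussMonomial, ← mul_pow, Complex.star_def, Complex.mul_conj, Complex.normSq_eq_norm_sq,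
      pow_mul]
    push_cast
    rfl
  simp only [h1]
  rw [integral_complex_ofReal, integral_norm_pow_mul_exp hN]
  have h2 : (((2 * m : ℕ) : ℝ) + 2) / 2 = m + 1 := by push_cast; ring
  have h3 : -(((2 * m : ℕ) : ℝ) + 2) / 2 = -((m + 1 : ℕ) : ℝ) := by push_cast; ring
  rw [h2, h3, Real.Gamma_nat_eq_factorial, Real.rpow_neg hN.le, Real.rpow_natCast]
  push_cast
  rw [pow_succ]
  field_simp

/-- Rotation invariance kills the unbalanced Gaussian moments. -/
lemma integral_gaussMonomial_of_ne {N : ℝ} {m l : ℕ} (hml : m ≠ l) :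
    ∫ q, gaussMonomial N m l q = 0 := by
  have hne : (m : ℝ) - l ≠ 0 := sub_ne_zero.mpr (by exact_mod_cast hml)
  let a : Circle := Circle.exp (Real.pi / ((m : ℝ) - l))
  have ha : (a : ℂ) ^ m * star (a : ℂ) ^ l = -1 := by
    have h1 : star (a : ℂ) = Complex.exp (-((Real.pi / ((m : ℝ) - l) : ℝ) * Complex.I)) := by
      rw [Circle.coe_exp, Complex.star_def, ← Complex.exp_conj]
      simp
    rw [h1, Circle.coe_exp, ← Complex.exp_nat_mul, ← Complex.exp_nat_mul, ← Complex.exp_add,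
      ← Complex.exp_pi_mul_I]
    congr 1
    have : (m : ℂ) - l ≠ 0 := by exact_mod_cast hne
    push_cast
    field_simp
    ring
  have h : ∫ q, gaussMonomial N m l (rotation a q) = ∫ q, gaussMonomial N m l q :=
    (rotation a).measurePreserving.integral_comp
      (rotation a).toHomeomorph.measurableEmbedding _
  have h2 : ∀ q, gaussMonomial N m l (rotation a q) = -gaussMonomial N m l q := by
    intro q
    simp only [gaussMonomial, rotation_apply, star_mul', mul_pow, norm_mul, Circle.norm_coe,
      one_mul]
    linear_combination (q ^ m * star q ^ l * (Real.exp (-N * ‖q‖ ^ 2) : ℂ)) * ha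
  simp only [h2, integral_neg] at h
  linear_combination (-1 / 2 : ℂ) * h

/-! ### The dual integral -/

/-- The five coordinates of a point `(Q, v)`. -/
def dualPt (x : (Fin 2 → Fin 2 → ℂ) × ℂ) : DualVar → ℂ
  | some e => x.1 e.1 e.2
  | none => x.2

lemma prod_dualPt (f : DualVar → ℂ → ℂ) (x : (Fin 2 → Fin 2 → ℂ) × ℂ) :
    ∏ i, f i (dualPt x i) = (∏ s, ∏ t, f (some (s, t)) (x.1 s t)) * f none x.2 := by
  rw [Fintype.prod_option, Fintype.prod_prod_type, mul_comm]
  rfl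

lemma integrable_prod_dualPt {f : DualVar → ℂ → ℂ} (hf : ∀ i, Integrable (f i)) :
    Integrable fun x => ∏ i, f i (dualPt x i) := by
  simp only [prod_dualPt]
  exact Integrable.mul_prod (Integrable.fintype_prod (f := fun s (y : Fin 2 → ℂ) =>
    ∏ t, f (some (s, t)) (y t)) fun s => Integrable.fintype_prod fun t => hf _) (hf none)

lemma integral_prod_dualPt (f : DualVar → ℂ → ℂ) :
    ∫ x, ∏ i, f i (dualPt x i) = ∏ i, ∫ q, f i q := by
  simp only [prod_dualPt]
  rw [Measure.volume_eq_prod, integral_prod_mul (fun y : Fin 2 → Fin 2 → ℂ =>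
    ∏ s, ∏ t, f (some (s, t)) (y s t)) (f none), integral_fintype_prod_volume_eq_prod
    (fun s (y : Fin 2 → ℂ) => ∏ t, f (some (s, t)) (y t)), Fintype.prod_option,
    Fintype.prod_prod_type, mul_comm]
  simp only [integral_fintype_prod_volume_eq_prod]

/-- The Gaussian weight on the space of the integration variables. -/
def dualWeight (N : ℝ) (x : (Fin 2 → Fin 2 → ℂ) × ℂ) : ℂ :=
  ∏ i, (Real.exp (-N * ‖dualPt x i‖ ^ 2) : ℂ)

variable {A : Type*} [CommRing A] [Algebra ℂ A]

/-- The reproducing property of the Gaussian weight: integrating a polynomial `P` in the variables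
`q` against the exponential of `∑ i, conj (q i) * α i`, with `α` nilpotent, evaluates `P` at `α`
divided by `N`. -/
lemma reproducing {N : ℝ} (hN : 0 < N) (K : ℕ) (α : DualVar → A) (hα : ∀ i, α i ^ K = 0)
    (B : A →ₗ[ℂ] ℂ) (P : MvPolynomial DualVar A) :
    Integrable (fun x => B (MvPolynomial.eval (fun i => algebraMap ℂ A (dualPt x i)) P *
        ∏ i, truncExp K (star (dualPt x i)) (α i)) * dualWeight N x) ∧
      ∫ x, B (MvPolynomial.eval (fun i => algebraMap ℂ A (dualPt x i)) P *
        ∏ i, truncExp K (star (dualPt x i)) (α i)) * dualWeight N x =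
      (Real.pi / N : ℂ) ^ 5 * B (MvPolynomial.eval (fun i => (1 / N : ℂ) • α i) P) := by
  induction P using MvPolynomial.induction_on' with
  | add P P' hP hP' =>
    simp only [map_add, add_mul, mul_add]
    exact ⟨hP.1.add hP'.1, by rw [integral_add hP.1 hP'.1, hP.2, hP'.2]⟩
  | monomial m a =>
    let F : (DualVar → ℕ) → DualVar → ℂ → ℂ := fun L i q =>
      (1 / ((L i).factorial : ℂ)) * gaussMonomial N (m i) (L i) q
    have hF : ∀ L i, Integrable (F L i) := fun L i => (integrable_gaussMonomial hN _ _).const_mul _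
    have hFi : ∀ L i, ∫ q, F L i q =
        if m i = L i then (Real.pi / N : ℂ) * (1 / N : ℂ) ^ m i else 0 := by
      intro L i
      rw [integral_const_mul]
      split_ifs with h
      · rw [← h, integral_gaussMonomial_self hN]
        have : ((m i).factorial : ℂ) ≠ 0 := by exact_mod_cast (m i).factorial_ne_zero
        rw [div_pow, one_pow]
        field_simp
      · rw [integral_gaussMonomial_of_ne h, mul_zero]
    have hexp : ∀ x, B (MvPolynomial.eval (fun i => algebraMap ℂ A (dualPt x i))
          (MvPolynomial.monomial m a) * ∏ i, truncExp K (star (dualPt x i)) (α i)) *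
          dualWeight N x =
        ∑ L ∈ Fintype.piFinset fun _ : DualVar => Finset.range K,
          B (a * ∏ i, α i ^ L i) * ∏ i, F L i (dualPt x i) := by
      intro x
      have e : ∀ L : DualVar → ℕ, a * ∏ i, algebraMap ℂ A (dualPt x i) ^ m i *
          ((star (dualPt x i) ^ L i / ((L i).factorial : ℂ)) • α i ^ L i) =
          (∏ i, dualPt x i ^ m i * (star (dualPt x i) ^ L i / ((L i).factorial : ℂ))) •
            (a * ∏ i, α i ^ L i) := by
        intro L
        simp only [Algebra.smul_def, Finset.prod_mul_distrib, map_prod, map_mul, map_pow]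
        ring
      rw [MvPolynomial.eval_monomial, Finsupp.prod_fintype _ _ (by simp)]
      simp only [truncExp]
      rw [mul_assoc, ← Finset.prod_mul_distrib]
      simp only [Finset.mul_sum]
      rw [Finset.prod_univ_sum, Finset.mul_sum]
      simp only [e]
      rw [map_sum, Finset.sum_mul]
      refine Finset.sum_congr rfl fun L _ => ?_
      rw [map_smul, smul_eq_mul, mul_comm (∏ i, _), mul_assoc, dualWeight,
        ← Finset.prod_mul_distrib]
      congr 1
      refine Finset.prod_congr rfl fun i _ => ?_
      simp only [F, gaussMonomial]
      ring
    have hint : ∀ L : DualVar → ℕ,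
        Integrable fun x => B (a * ∏ i, α i ^ L i) * ∏ i, F L i (dualPt x i) :=
      fun L => (integrable_prod_dualPt (hF L)).const_mul _
    simp only [hexp]
    refine ⟨integrable_finsetSum _ fun L _ => hint L, ?_⟩
    rw [integral_finsetSum _ fun L _ => hint L]
    simp only [integral_const_mul, integral_prod_dualPt, hFi]
    have hval : MvPolynomial.eval (fun i => (1 / N : ℂ) • α i) (MvPolynomial.monomial m a) =
        (∏ i, (1 / N : ℂ) ^ m i) • (a * ∏ i, α i ^ m i) := by
      rw [MvPolynomial.eval_monomial, Finsupp.prod_fintype _ _ (by simp)]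
      simp only [Algebra.smul_def, Finset.prod_mul_distrib, map_prod, map_pow, mul_pow]
      ring
    rw [hval, map_smul, Finset.sum_eq_single (fun i => m i)]
    · simp only [if_true, Finset.prod_mul_distrib, smul_eq_mul]
      rw [Finset.prod_const]
      simp [DualVar]
      ring
    · intro L _ hL
      obtain ⟨i, hi⟩ := Function.ne_iff.mp hL
      exact mul_eq_zero_of_right _ (Finset.prod_eq_zero (Finset.mem_univ i) (if_neg (Ne.symm hi)))
    · intro hm
      obtain ⟨i, hi⟩ : ∃ i, K ≤ m i := by
        by_contra! hcon
        exact hm (Fintype.mem_piFinset.mpr fun i => Finset.mem_range.mpr (hcon i))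
      have : ∏ i, α i ^ m i = 0 :=
        Finset.prod_eq_zero (Finset.mem_univ i) (pow_eq_zero_of_le hi (hα i))
      rw [this, mul_zero, map_zero, zero_mul]

/-! ### Means of products of independent entries -/

section Moments

variable {Ω : Type*} [MeasurableSpace Ω] {μ : Measure Ω}

lemma integrable_prod_comp_of_iIndepFun {ι : Type*} [Fintype ι] {X : ι → Ω → ℂ}
    (hX : iIndepFun X μ) (mX : ∀ i, Measurable (X i)) {f : ι → ℂ → ℂ} (mf : ∀ i, Measurable (f i))
    (hf : ∀ i, Integrable (fun ω => f i (X i ω)) μ) :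
    Integrable (fun ω => ∏ i, f i (X i ω)) μ := by
  have := hX.isProbabilityMeasure
  have hp : ∀ i, IsProbabilityMeasure (μ.map (X i)) := fun i =>
    Measure.isProbabilityMeasure_map (mX i).aemeasurable
  have h : Integrable (fun y : ι → ℂ => ∏ i, f i (y i)) (μ.map fun ω i => X i ω) := by
    rw [hX.map_fun_eq_pi_map fun i => (mX i).aemeasurable]
    refine Integrable.fintype_prod fun i => ?_
    rw [integrable_map_measure (mf i).aestronglyMeasurable (mX i).aemeasurable]
    exact hf i
  exact h.comp_measurable (measurable_pi_lambda _ mX)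

/-- The moments of order at most two in an entry and at most two in its conjugate, for the second
absolute moment `σ` and the fourth cumulant `τ`. -/
def momentSeq (σ τ : ℂ) : ℕ → ℂ
  | 0 => 1
  | 1 => σ
  | _ => 2 * σ ^ 2 + τ

lemma multiset_prod_eq_prod_pow_count {ι : Type*} [Fintype ι] [DecidableEq ι] (f : ι → ℂ)
    (s : Multiset ι) : (s.map f).prod = ∏ k, f k ^ s.count k := by
  induction s using Multiset.induction_on with
  | empty => simp
  | cons a s ih =>
    simp only [Multiset.map_cons, Multiset.prod_cons, Multiset.count_cons, pow_add,
      Finset.prod_mul_distrib, ih, mul_comm (f a)]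
    simp

lemma integrable_norm_one_add_pow [IsProbabilityMeasure μ] {x : Ω → ℂ} (hx : MemLp x 4 μ) (C : ℝ) :
    Integrable (fun ω => (C + ‖x ω‖) ^ 4) μ := by
  have h := ((memLp_const C).add hx.norm).integrable_norm_pow (p := 4) (by norm_num)
  refine h.congr (Filter.Eventually.of_forall fun ω => ?_)
  simp only [Pi.add_apply, Real.norm_eq_abs]
  exact Even.pow_abs (by decide) _

/-- A mean over a row of independent entries factorizes into the moments of the entries. -/
lemma integral_multiset_prod [IsProbabilityMeasure μ] {σ τ : ℂ} {x : Fin n → Ω → ℂ}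
    (hind : iIndepFun x μ) (hmeas : ∀ k, Measurable (x k)) (hL : ∀ k, MemLp (x k) 4 μ)
    (hmom : ∀ k a b, a ≤ 2 → b ≤ 2 →
      ∫ ω, x k ω ^ a * star (x k ω) ^ b ∂μ = if a = b then momentSeq σ τ a else 0)
    (s t : Multiset (Fin n)) (hs : s.card ≤ 2) (ht : t.card ≤ 2) :
    Integrable (fun ω => (s.map fun k => x k ω).prod * (t.map fun k => star (x k ω)).prod) μ ∧
      ∫ ω, (s.map fun k => x k ω).prod * (t.map fun k => star (x k ω)).prod ∂μ =
        if s = t then ∏ k, momentSeq σ τ (s.count k) else 0 := by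
  have e : ∀ ω, (s.map fun k => x k ω).prod * (t.map fun k => star (x k ω)).prod =
      ∏ k, x k ω ^ s.count k * star (x k ω) ^ t.count k := by
    intro ω
    rw [multiset_prod_eq_prod_pow_count, multiset_prod_eq_prod_pow_count, Finset.prod_mul_distrib]
  have hs' : ∀ k, s.count k ≤ 2 := fun k => (Multiset.count_le_card k s).trans hs
  have ht' : ∀ k, t.count k ≤ 2 := fun k => (Multiset.count_le_card k t).trans ht
  simp only [e]
  constructor
  · refine integrable_prod_comp_of_iIndepFun hind hmeas
      (f := fun k y => y ^ s.count k * star y ^ t.count k) (fun k => by fun_prop) fun k => ?_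
    refine (integrable_norm_one_add_pow (hL k) 1).mono
      ((by fun_prop : Measurable fun y : ℂ => y ^ s.count k * star y ^ t.count k).comp
        (hmeas k)).aestronglyMeasurable (Filter.Eventually.of_forall fun ω => ?_)
    rw [norm_mul, norm_pow, norm_pow, norm_star, ← pow_add, Real.norm_eq_abs,
      abs_of_nonneg (by positivity)]
    calc ‖x k ω‖ ^ (s.count k + t.count k) ≤ (1 + ‖x k ω‖) ^ (s.count k + t.count k) := by
          gcongr; linarith
      _ ≤ (1 + ‖x k ω‖) ^ 4 := by
          have := hs' k
          have := ht' k
          exact pow_le_pow_right₀ (by linarith [norm_nonneg (x k ω)]) (by omega)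
  · rw [hind.integral_fun_prod_comp (f := fun k y => y ^ s.count k * star y ^ t.count k)
      (fun k => (hmeas k).aemeasurable) (fun k => Measurable.aestronglyMeasurable (by fun_prop))]
    simp only [fun k => hmom k _ _ (hs' k) (ht' k)]
    split_ifs with h
    · simp [h]
    · obtain ⟨k, hk⟩ : ∃ k, s.count k ≠ t.count k := by
        by_contra! hcon
        exact h (Multiset.ext.mpr hcon)
      exact Finset.prod_eq_zero (Finset.mem_univ k) (if_neg hk)

lemma prod_momentSeq_count_singleton (σ τ : ℂ) (k : Fin n) :
    ∏ i, momentSeq σ τ (({k} : Multiset (Fin n)).count i) = σ := by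
  rw [Finset.prod_eq_single k]
  · simp [momentSeq]
  · intro i _ hi
    simp [hi, momentSeq]
  · simp

lemma prod_momentSeq_count_pair (σ τ : ℂ) (k l : Fin n) :
    ∏ i, momentSeq σ τ (({k, l} : Multiset (Fin n)).count i) =
      if k = l then 2 * σ ^ 2 + τ else σ ^ 2 := by
  split_ifs with h
  · subst h
    rw [Finset.prod_eq_single k]
    · simp [momentSeq]
    · intro i _ hi
      simp [hi, momentSeq]
    · simp
  · have : ∀ i, momentSeq σ τ (({k, l} : Multiset (Fin n)).count i) =
        (if i = k then σ else 1) * (if i = l then σ else 1) := by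
      intro i
      simp only [Multiset.insert_eq_cons, Multiset.count_cons, Multiset.count_singleton]
      by_cases h1 : i = k
      · have h2 : i ≠ l := fun h2 => h (h1.symm.trans h2)
        simp [h1, h, momentSeq]
      · by_cases h2 : i = l <;> simp [h1, h2, momentSeq]
        simp [Ne.symm h]
    simp only [this, Finset.prod_mul_distrib, Finset.prod_ite_eq', Finset.mem_univ, if_true, sq]

lemma pair_eq_pair_iff {k l m r : Fin n} :
    ({k, l} : Multiset (Fin n)) = {m, r} ↔ (k = m ∧ l = r) ∨ (k = r ∧ l = m) := by
  constructor
  · intro h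
    simp only [Multiset.insert_eq_cons, Multiset.cons_eq_cons, Multiset.singleton_inj,
      Multiset.singleton_eq_cons_iff] at h
    rcases h with h | ⟨_, _, ⟨h1, _⟩, h2, _⟩
    · exact Or.inl h
    · exact Or.inr ⟨h2.symm, h1⟩
  · rintro (⟨rfl, rfl⟩ | ⟨rfl, rfl⟩)
    · rfl
    · exact Multiset.pair_comm _ _

/-- The two ways to pair two entries with two conjugate entries. -/
lemma ite_pairing (σ τ : ℂ) (a b c d : Fin n) :
    (if a = c ∧ b = d ∨ a = d ∧ b = c then if a = b then 2 * σ ^ 2 + τ else σ ^ 2 else 0) =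
      σ ^ 2 * (if c = a ∧ d = b then 1 else 0) + σ ^ 2 * (if c = b ∧ d = a then 1 else 0)
        + τ * (if b = a ∧ c = a ∧ d = a then 1 else 0) := by
  grind

/-- The four copies of an entry: twice itself and twice its conjugate. -/
def entryCopy (s : Fin 4) (x : ℂ) : ℂ := ![x, x, star x, star x] s

/-- The mean of a product of four entries of a row with independent entries. -/
lemma integral_row [IsProbabilityMeasure μ] {σ τ : ℂ} {x : Fin n → Ω → ℂ}
    (hind : iIndepFun x μ) (hmeas : ∀ k, Measurable (x k)) (hL : ∀ k, MemLp (x k) 4 μ)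
    (hmom : ∀ k a b, a ≤ 2 → b ≤ 2 →
      ∫ ω, x k ω ^ a * star (x k ω) ^ b ∂μ = if a = b then momentSeq σ τ a else 0)
    (ζ : Fin 4 → ℂ) (j : Fin n) (κ : Fin 4 → Fin n) :
    ∫ ω, ∏ s, (entryCopy s (x (κ s) ω) + ζ s * if κ s = j then 1 else 0) ∂μ =
      rowMean σ τ ζ j κ := by
  let c : Fin 4 → ℂ := fun s => ζ s * if κ s = j then 1 else 0
  -- expand the two factors with entries and the two factors with conjugates separately
  let S : Fin 4 → Multiset (Fin n) := ![{κ 0, κ 1}, {κ 0}, {κ 1}, 0]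
  let T : Fin 4 → Multiset (Fin n) := ![{κ 2, κ 3}, {κ 2}, {κ 3}, 0]
  let C : Fin 4 → ℂ := ![1, c 1, c 0, c 0 * c 1]
  let C' : Fin 4 → ℂ := ![1, c 3, c 2, c 2 * c 3]
  have hS : ∀ i, (S i).card ≤ 2 := by intro i; fin_cases i <;> simp [S]
  have hT : ∀ i, (T i).card ≤ 2 := by intro i; fin_cases i <;> simp [T]
  have hI := fun i i' => integral_multiset_prod hind hmeas hL hmom (S i) (T i') (hS i) (hT i')
  have e : ∀ ω, ∏ s, (entryCopy s (x (κ s) ω) + ζ s * if κ s = j then 1 else 0) =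
      ∑ i, ∑ i', C i * C' i' * (((S i).map fun k => x k ω).prod *
        ((T i').map fun k => star (x k ω)).prod) := by
    intro ω
    change ∏ s, (entryCopy s (x (κ s) ω) + c s) = _
    simp [Fin.prod_univ_four, Fin.sum_univ_four, entryCopy, S, T, C, C']
    ring
  simp only [e]
  rw [integral_finsetSum _ fun i _ => integrable_finsetSum _ fun i' _ => (hI i i').1.const_mul _]
  simp only [integral_finsetSum _ fun i' _ => (hI _ i').1.const_mul _, integral_const_mul,
    (hI _ _).2]
  have hκ : ∀ a b c d, κ = ![a, b, c, d] ↔ κ 0 = a ∧ κ 1 = b ∧ κ 2 = c ∧ κ 3 = d := by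
    intro a b c d
    simp [funext_iff, Fin.forall_fin_succ]
  have m1 : ∀ a b c : Fin n, ({a, b} : Multiset (Fin n)) ≠ {c} := fun a b c h => by
    simpa using congrArg Multiset.card h
  have m2 : ∀ a b c : Fin n, ({c} : Multiset (Fin n)) ≠ {a, b} := fun a b c h => m1 a b c h.symm
  have m3 : ∀ a b : Fin n, ({a, b} : Multiset (Fin n)) ≠ 0 := fun a b h => by
    simpa using congrArg Multiset.card h
  have m4 : ∀ a b : Fin n, (0 : Multiset (Fin n)) ≠ {a, b} := fun a b h => m3 a b h.symm
  have m5 : ∀ a : Fin n, ({a} : Multiset (Fin n)) ≠ 0 := fun a => Multiset.singleton_ne_zero a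
  have m6 : ∀ a : Fin n, (0 : Multiset (Fin n)) ≠ {a} := fun a => (m5 a).symm
  have hsum : ∀ (a : Fin n) (P : Fin n → Prop) [DecidablePred P],
      ∑ k, (if a = k ∧ P k then (1 : ℂ) else 0) = if P a then 1 else 0 := by
    intro a P _
    simp [ite_and]
  have hsum₂ : ∀ (a b : Fin n) (P : Fin n → Fin n → Prop) [∀ k, DecidablePred (P k)],
      ∑ k, ∑ l, (if a = k ∧ b = l ∧ P k l then (1 : ℂ) else 0) = if P a b then 1 else 0 := by
    intro a b P _
    rw [Finset.sum_comm]
    simp only [hsum a fun k => b = _ ∧ P k _, hsum]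
  have t1 : c 1 * c 3 * (if κ 0 = κ 2 then σ else 0) =
      σ * ζ 1 * ζ 3 * (if κ 1 = j ∧ κ 2 = κ 0 ∧ κ 3 = j then 1 else 0) := by
    simp only [c]; grind
  have t2 : c 1 * c 2 * (if κ 0 = κ 3 then σ else 0) =
      σ * ζ 1 * ζ 2 * (if κ 1 = j ∧ κ 2 = j ∧ κ 3 = κ 0 then 1 else 0) := by
    simp only [c]; grind
  have t3 : c 0 * c 3 * (if κ 1 = κ 2 then σ else 0) =
      σ * ζ 0 * ζ 3 * (if κ 0 = j ∧ κ 2 = κ 1 ∧ κ 3 = j then 1 else 0) := by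
    simp only [c]; grind
  have t4 : c 0 * c 2 * (if κ 1 = κ 3 then σ else 0) =
      σ * ζ 0 * ζ 2 * (if κ 0 = j ∧ κ 2 = j ∧ κ 3 = κ 1 then 1 else 0) := by
    simp only [c]; grind
  have t5 : c 0 * c 1 * (c 2 * c 3) =
      ζ 0 * ζ 1 * ζ 2 * ζ 3 *
        (if κ 0 = j ∧ κ 1 = j ∧ κ 2 = j ∧ κ 3 = j then 1 else 0) := by
    simp only [c, ite_and]
    split_ifs <;> ring
  simp only [Fin.sum_univ_four, S, T, C, C', rowMean, hκ, Matrix.cons_val, pair_eq_pair_iff,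
    prod_momentSeq_count_pair, prod_momentSeq_count_singleton, Multiset.singleton_inj,
    m1, m2, m3, m4, m5, m6, if_false, hsum, hsum₂, and_left_comm (a := κ 0 = j), ite_pairing]
  simp only [Multiset.count_zero, momentSeq, Finset.prod_const_one, if_true]
  simp only [and_left_comm (b := κ 0 = j)]
  linear_combination t1 + t2 + t3 + t4 + t5

end Moments

section Matrix

variable {Ω : Type*} [MeasurableSpace Ω] {μ : Measure Ω}

lemma measurable_entryCopy (s : Fin 4) : Measurable (entryCopy s) := by
  unfold entryCopy
  fin_cases s <;> simp <;> fun_prop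

lemma norm_entryCopy (s : Fin 4) (y : ℂ) : ‖entryCopy s y‖ = ‖y‖ := by
  fin_cases s <;> simp [entryCopy]

lemma integrable_prod_entryCopy_add [IsProbabilityMeasure μ] {x : Ω → ℂ} (hx : Measurable x)
    (hL : MemLp x 4 μ) (F : Finset (Fin 4)) (c : Fin 4 → ℂ) :
    Integrable (fun ω => ∏ s ∈ F, (entryCopy s (x ω) + c s)) μ := by
  have hC : ∀ s, ‖c s‖ ≤ ∑ r, ‖c r‖ := fun s =>
    Finset.single_le_sum (f := fun r => ‖c r‖) (fun _ _ => norm_nonneg _) (Finset.mem_univ s)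
  have hC0 : 0 ≤ ∑ r, ‖c r‖ := Finset.sum_nonneg fun _ _ => norm_nonneg _
  refine (integrable_norm_one_add_pow hL (1 + ∑ r, ‖c r‖)).mono
    (Finset.measurable_fun_prod F fun s _ =>
      ((measurable_entryCopy s).comp hx).add_const (c s)).aestronglyMeasurable
    (Filter.Eventually.of_forall fun ω => ?_)
  have h1 : 1 ≤ 1 + ∑ r, ‖c r‖ + ‖x ω‖ := by linarith [norm_nonneg (x ω)]
  rw [norm_prod, Real.norm_eq_abs, abs_of_nonneg (by positivity)]
  calc ∏ s ∈ F, ‖entryCopy s (x ω) + c s‖ ≤ ∏ s ∈ F, (1 + ∑ r, ‖c r‖ + ‖x ω‖) := by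
        refine Finset.prod_le_prod (fun _ _ => norm_nonneg _) fun s _ => ?_
        have := norm_add_le (entryCopy s (x ω)) (c s)
        rw [norm_entryCopy] at this
        linarith [hC s]
    _ = (1 + ∑ r, ‖c r‖ + ‖x ω‖) ^ F.card := by rw [Finset.prod_const]
    _ ≤ (1 + ∑ r, ‖c r‖ + ‖x ω‖) ^ 4 :=
        pow_le_pow_right₀ h1 ((Finset.card_le_univ F).trans (by simp))

/-- The mean of a product of four entries from each row of a matrix with independent entries. -/
lemma integral_prod_rows [IsProbabilityMeasure μ] {σ τ : ℂ} {x : Fin n → Fin n → Ω → ℂ}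
    (hind : iIndepFun (fun (e : Fin n × Fin n) => x e.1 e.2) μ)
    (hmeas : ∀ j k, Measurable (x j k)) (hL : ∀ j k, MemLp (x j k) 4 μ)
    (hmom : ∀ j k a b, a ≤ 2 → b ≤ 2 →
      ∫ ω, x j k ω ^ a * star (x j k ω) ^ b ∂μ = if a = b then momentSeq σ τ a else 0)
    (ζ : Fin 4 → ℂ) (K : Fin n → Fin 4 → Fin n) :
    Integrable (fun ω => ∏ j, ∏ s,
        (entryCopy s (x j (K j s) ω) + ζ s * if K j s = j then 1 else 0)) μ ∧
      ∫ ω, ∏ j, ∏ s, (entryCopy s (x j (K j s) ω) + ζ s * if K j s = j then 1 else 0) ∂μ =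
        ∏ j, rowMean σ τ ζ j (K j) := by
  -- group the factors by the entry that they contain
  let g : Fin n × Fin n → ℂ → ℂ := fun e y =>
    ∏ s with K e.1 s = e.2, (entryCopy s y + ζ s * if e.2 = e.1 then 1 else 0)
  have hrow : ∀ j ω, ∏ s, (entryCopy s (x j (K j s) ω) + ζ s * if K j s = j then 1 else 0) =
      ∏ k, g (j, k) (x j k ω) := by
    intro j ω
    rw [← Finset.prod_fiberwise _ (K j)]
    refine Finset.prod_congr rfl fun k _ => Finset.prod_congr rfl fun s hs => ?_
    rw [(Finset.mem_filter.mp hs).2]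
  have mg : ∀ e, Measurable (g e) := fun e =>
    Finset.measurable_fun_prod _ fun s _ => (measurable_entryCopy s).add_const _
  have hg : ∀ e : Fin n × Fin n, Integrable (fun ω => g e (x e.1 e.2 ω)) μ := fun e =>
    integrable_prod_entryCopy_add (hmeas _ _) (hL _ _) _ _
  have hall : ∀ ω, ∏ j, ∏ k, g (j, k) (x j k ω) = ∏ e : Fin n × Fin n, g e (x e.1 e.2 ω) :=
    fun ω => (Fintype.prod_prod_type fun e : Fin n × Fin n => g e (x e.1 e.2 ω)).symm
  constructor
  · simp only [hrow, hall]
    exact integrable_prod_comp_of_iIndepFun hind (fun e => hmeas _ _) mg hg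
  · have hrowind : ∀ j, iIndepFun (x j) μ := fun j =>
      hind.precomp (g := fun k => (j, k)) (Prod.mk_right_injective j)
    simp only [← fun j => integral_row (hrowind j) (hmeas j) (hL j) (hmom j) ζ j (K j), hrow, hall]
    rw [hind.integral_fun_prod_comp (fun e => (hmeas _ _).aemeasurable)
      (fun e => (mg e).aestronglyMeasurable), Fintype.prod_prod_type]
    refine Finset.prod_congr rfl fun j _ => ?_
    rw [(hrowind j).integral_fun_prod_comp (f := fun k => g (j, k))
      (fun k => (hmeas _ _).aemeasurable) (fun k => (mg _).aestronglyMeasurable)]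

/-- The diagonal shifts of the four matrices whose determinants are multiplied. -/
def shifts (z₁ z₂ : ℂ) : Fin 4 → ℂ := ![-z₁, -z₂, -star z₁, -star z₂]

/-- The determinant of a conjugate transpose is that of the entrywise conjugate, so that the rows of
all four matrices are made of the same row of `H`. -/
lemma charPolyProd_eq_prod_det (H : Matrix (Fin n) (Fin n) ℂ) (z₁ z₂ : ℂ) :
    charPolyProd H ![z₁, z₂] = ∏ s, (Matrix.of fun j k =>
      entryCopy s (H j k) + shifts z₁ z₂ s * if k = j then 1 else 0).det := by
  have h1 : ∀ z : ℂ, H - z • (1 : Matrix (Fin n) (Fin n) ℂ) =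
      Matrix.of fun j k => H j k + -z * if k = j then 1 else 0 := by
    intro z
    ext j k
    by_cases h : j = k <;> simp [h, sub_eq_add_neg, eq_comm]
  have h2 : ∀ z : ℂ, (H - z • (1 : Matrix (Fin n) (Fin n) ℂ))ᴴ.det =
      (Matrix.of fun j k => star (H j k) + -star z * if k = j then 1 else 0).det := by
    intro z
    rw [← Matrix.det_transpose, h1]
    congr 1
    ext j k
    by_cases h : j = k <;> simp [h, Ne.symm]
  simp only [charPolyProd, Fin.prod_univ_two, Fin.prod_univ_four]
  simp only [Matrix.cons_val_zero, Matrix.cons_val_one, h2]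
  simp only [h1]
  simp [entryCopy, shifts]
  ring

/-- The second correlation function is the Berezin integral of the product of the averaged rows. -/
lemma corrFun_eq_berezin [IsProbabilityMeasure μ] {σ b : ℂ} {x : Fin n → Fin n → Ω → ℂ}
    (hind : iIndepFun (fun (e : Fin n × Fin n) => x e.1 e.2) μ)
    (hmeas : ∀ j k, Measurable (x j k)) (hL : ∀ j k, MemLp (x j k) 4 μ)
    (hmom : ∀ j k a b', a ≤ 2 → b' ≤ 2 →
      ∫ ω, x j k ω ^ a * star (x j k ω) ^ b' ∂μ =
        if a = b' then momentSeq σ (σ * b ^ 2) a else 0) (z₁ z₂ : ℂ) :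
    Integrable (fun ω => charPolyProd (Matrix.of fun j k => x j k ω) ![z₁, z₂]) μ ∧
      corrFun μ (fun ω => Matrix.of fun j k => x j k ω) ![z₁, z₂] =
        berezin n (centerVal n (MvPolynomial.eval (fun i => σ • dualVec n b i)
          (∏ j, rowPoly b (shifts z₁ z₂) j))) := by
  have hK := integral_prod_rows hind hmeas hL hmom (shifts z₁ z₂)
  simp only [corrFun, charPolyProd_eq_prod_det, prod_det_eq_sum, Matrix.of_apply]
  constructor
  · exact integrable_finsetSum _ fun K _ => (hK K).1.mul_const _
  · rw [integral_finsetSum _ fun K _ => (hK K).1.mul_const _]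
    simp only [integral_mul_const, (hK _).2, map_prod (MvPolynomial.eval _), eval_rowPoly_dualVec]
    rw [berezin_prod_sum_smul_genQuad fun j κ => rowMean σ (σ * b ^ 2) (shifts z₁ z₂) j κ]

end Matrix

/-! ### The entries of the sparse ensemble -/

section Ensemble

variable {Ω : Type*} [MeasurableSpace Ω] {μ : Measure Ω} {p : ℝ}
  {d : Fin n → Fin n → Ω → ℝ} {w : Fin n → Fin n → Ω → ℂ}

lemma IsSparseEnsemble.indepFun_entry (hX : IsSparseEnsemble μ n p d w) (j k : Fin n) :
    IndepFun (d j k) (w j k) μ :=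
  hX.indep_d_w.comp (φ := fun a : Fin n × Fin n → ℝ => a (j, k))
    (ψ := fun a : Fin n × Fin n → ℂ => a (j, k)) (by fun_prop) (by fun_prop)

variable [IsProbabilityMeasure μ]

/-- Two mutually independent families of independent variables form a family of independent pairs. -/
lemma IsSparseEnsemble.iIndepFun_entries (hX : IsSparseEnsemble μ n p d w) :
    iIndepFun (fun (e : Fin n × Fin n) ω => (d e.1 e.2 ω : ℂ) * w e.1 e.2 ω) μ := by
  have md : ∀ e : Fin n × Fin n, Measurable (d e.1 e.2) := fun e => hX.measurable_d _ _
  have mw : ∀ e : Fin n × Fin n, Measurable (w e.1 e.2) := fun e => hX.measurable_w _ _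
  have hpd : ∀ e : Fin n × Fin n, IsProbabilityMeasure (μ.map (d e.1 e.2)) := fun e =>
    Measure.isProbabilityMeasure_map (md e).aemeasurable
  have hpw : ∀ e : Fin n × Fin n, IsProbabilityMeasure (μ.map (w e.1 e.2)) := fun e =>
    Measure.isProbabilityMeasure_map (mw e).aemeasurable
  have hpair : iIndepFun (fun (e : Fin n × Fin n) ω => (d e.1 e.2 ω, w e.1 e.2 ω)) μ := by
    rw [iIndepFun_iff_map_fun_eq_pi_map fun e => ((md e).prodMk (mw e)).aemeasurable]
    have h1 : ∀ e : Fin n × Fin n, μ.map (fun ω => (d e.1 e.2 ω, w e.1 e.2 ω)) =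
        (μ.map (d e.1 e.2)).prod (μ.map (w e.1 e.2)) := fun e =>
      (hX.indepFun_entry e.1 e.2).map_prod_eq_prod_map_map (md e).aemeasurable (mw e).aemeasurable
    have h2 := hX.indep_d_w.map_prod_eq_prod_map_map (measurable_pi_lambda _ md).aemeasurable
      (measurable_pi_lambda _ mw).aemeasurable
    rw [hX.indep_d.map_fun_eq_pi_map fun e => (md e).aemeasurable,
      hX.indep_w.map_fun_eq_pi_map fun e => (mw e).aemeasurable] at h2
    have h3 := measurePreserving_arrowProdEquivProdArrow ℝ ℂ (Fin n × Fin n)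
      (fun e => μ.map (d e.1 e.2)) (fun e => μ.map (w e.1 e.2))
    have h4 := h3.symm.map_eq
    rw [← h2, Measure.map_map (MeasurableEquiv.measurable _)
      ((measurable_pi_lambda _ md).prodMk (measurable_pi_lambda _ mw))] at h4
    simp only [h1]
    exact h4
  exact hpair.comp (fun _ y => (y.1 : ℂ) * y.2) fun _ => by fun_prop

/-- The two values of `d` exhaust the probability. -/
lemma IsSparseEnsemble.ae_d (hX : IsSparseEnsemble μ n p d w) (hp : 0 < p) (j k : Fin n) :
    ∀ᵐ ω ∂μ, d j k ω = 1 / √p ∨ d j k ω = 0 := by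
  have hc : 1 / √p ≠ 0 := by positivity
  have m1 : MeasurableSet {ω | d j k ω = 1 / √p} := hX.measurable_d j k (measurableSet_singleton _)
  have m0 : MeasurableSet {ω | d j k ω = 0} := hX.measurable_d j k (measurableSet_singleton _)
  have hdis : Disjoint {ω | d j k ω = 1 / √p} {ω | d j k ω = 0} := by
    rw [Set.disjoint_left]
    intro ω h1 h0
    exact hc (h1.symm.trans h0)
  have h := measureReal_union (μ := μ) hdis m0
  rw [hX.prob_d_one, hX.prob_d_zero, add_sub_cancel] at h
  exact (prob_compl_eq_zero_iff (m1.union m0)).mpr (by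
    rwa [measureReal_def, ENNReal.toReal_eq_one_iff] at h)

lemma IsSparseEnsemble.integral_d_pow (hX : IsSparseEnsemble μ n p d w) (hp : 0 < p)
    (j k : Fin n) {m : ℕ} (hm : m ≠ 0) :
    ∫ ω, (d j k ω : ℂ) ^ m ∂μ = ((1 / √p) ^ m * (p / n) : ℝ) := by
  have h : (fun ω => (d j k ω : ℂ) ^ m) =ᵐ[μ]
      Set.indicator {ω | d j k ω = 1 / √p} fun _ => (((1 / √p) ^ m : ℝ) : ℂ) := by
    filter_upwards [hX.ae_d hp j k] with ω hω
    rcases hω with h | h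
    · rw [Set.indicator_of_mem (by exact h), h]; push_cast; rfl
    · have hc : (0 : ℝ) ≠ 1 / √p := (by positivity : 1 / √p ≠ 0).symm
      rw [Set.indicator_of_notMem (by rwa [Set.mem_ofPred_eq, h]), h]
      simp [hm]
  have hm1 : MeasurableSet {ω | d j k ω = 1 / √p} :=
    hX.measurable_d j k (measurableSet_singleton _)
  rw [integral_congr_ae h, integral_indicator_const _ hm1, hX.prob_d_one, Complex.real_smul]
  push_cast
  ring

lemma IsSparseEnsemble.memLp_entry (hX : IsSparseEnsemble μ n p d w) (hp : 0 < p) (j k : Fin n) :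
    MemLp (fun ω => (d j k ω : ℂ) * w j k ω) 4 μ := by
  refine (hX.memLp_w j k).of_le_mul (c := 1 / √p)
    ((Complex.measurable_ofReal.comp (hX.measurable_d j k)).mul
      (hX.measurable_w j k)).aestronglyMeasurable ?_
  filter_upwards [hX.ae_d hp j k] with ω hω
  rw [norm_mul]
  gcongr
  rcases hω with h | h <;> rw [h] <;> simp [abs_of_nonneg, Real.sqrt_nonneg]

/-- The moments of `w` that enter: of the monomials of degree at most two in `w` and at most two in
its conjugate, only the balanced ones have a non-zero mean. -/
lemma IsSparseEnsemble.integral_w (hX : IsSparseEnsemble μ n p d w) (j k : Fin n) (a b : ℕ)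
    (ha : a ≤ 2) (hb : b ≤ 2) :
    ∫ ω, w j k ω ^ a * star (w j k ω) ^ b ∂μ = if a = b then (a.factorial : ℂ) else 0 := by
  have hconj : ∀ f : Ω → ℂ, ∫ ω, star (f ω) ∂μ = star (∫ ω, f ω ∂μ) := fun f => integral_conj
  have hsq : ∀ ω, w j k ω * star (w j k ω) = ((‖w j k ω‖ ^ 2 : ℝ) : ℂ) := fun ω => by
    rw [Complex.star_def, Complex.mul_conj, Complex.normSq_eq_norm_sq]
  have h10 := hX.mean_w j k
  have h20 := hX.mean_w_sq j k
  have h11 : ∫ ω, w j k ω * star (w j k ω) ∂μ = 1 := by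
    simp only [hsq]
    rw [integral_complex_ofReal, hX.mean_norm_w_sq, Complex.ofReal_one]
  have h21 : ∫ ω, w j k ω ^ 2 * star (w j k ω) ∂μ = 0 := by
    rw [← hX.mean_norm_w_sq_mul_w j k]
    congr 1; ext ω; rw [← hsq]; ring
  have h22 : ∫ ω, w j k ω ^ 2 * star (w j k ω) ^ 2 ∂μ = 2 := by
    have : ∀ ω, w j k ω ^ 2 * star (w j k ω) ^ 2 = ((‖w j k ω‖ ^ 4 : ℝ) : ℂ) := fun ω => by
      rw [← mul_pow, hsq]; push_cast; ring
    simp only [this]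
    rw [integral_complex_ofReal, hX.mean_norm_w_fourth]; norm_num
  have h01 : ∫ ω, star (w j k ω) ∂μ = 0 := by rw [hconj, h10, star_zero]
  have h02 : ∫ ω, star (w j k ω) ^ 2 ∂μ = 0 := by
    simp only [← star_pow]; rw [hconj, h20, star_zero]
  have h12 : ∫ ω, w j k ω * star (w j k ω) ^ 2 ∂μ = 0 := by
    have : ∀ ω, w j k ω * star (w j k ω) ^ 2 = star (w j k ω ^ 2 * star (w j k ω)) := fun ω => by
      rw [star_mul', star_pow, star_star, mul_comm]
    simp only [this]; rw [hconj, h21, star_zero]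
  interval_cases a <;> interval_cases b <;>
    simp only [pow_zero, pow_one, one_mul, mul_one, h10, h20, h11, h21, h22, h01, h02, h12] <;>
    simp

lemma bParam_sq (hp : 0 < p) (hpn : p ≤ n) :
    bParam n p ^ 2 = 2 * ((n : ℝ) - p) / ((n : ℝ) * p) :=
  Real.sq_sqrt (div_nonneg (by linarith) (by positivity))

/-- The entries have the second moment `1 / n` and the fourth cumulant `b ^ 2 / n`. -/
lemma IsSparseEnsemble.integral_entry (hX : IsSparseEnsemble μ n p d w) (hp : 0 < p)
    (hpn : p ≤ n) (j k : Fin n) (a b : ℕ) (ha : a ≤ 2) (hb : b ≤ 2) :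
    ∫ ω, ((d j k ω : ℂ) * w j k ω) ^ a * star ((d j k ω : ℂ) * w j k ω) ^ b ∂μ =
      if a = b then momentSeq (1 / n) (1 / n * (bParam n p : ℂ) ^ 2) a else 0 := by
  have hn : (n : ℝ) ≠ 0 := (hp.trans_le hpn).ne'
  have e : ∀ ω, ((d j k ω : ℂ) * w j k ω) ^ a * star ((d j k ω : ℂ) * w j k ω) ^ b =
      (d j k ω : ℂ) ^ (a + b) * (w j k ω ^ a * star (w j k ω) ^ b) := by
    intro ω
    simp only [star_mul', Complex.star_def, Complex.conj_ofReal, mul_pow, pow_add]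
    ring
  have hind : IndepFun (fun ω => (d j k ω : ℂ) ^ (a + b))
      (fun ω => w j k ω ^ a * star (w j k ω) ^ b) μ :=
    (hX.indepFun_entry j k).comp (φ := fun y : ℝ => (y : ℂ) ^ (a + b))
      (ψ := fun y : ℂ => y ^ a * star y ^ b) (by fun_prop) (by fun_prop)
  have md := hX.measurable_d j k
  have mw := hX.measurable_w j k
  simp only [e]
  rw [hind.integral_fun_mul_eq_mul_integral (by fun_prop) (by fun_prop),
    hX.integral_w j k a b ha hb]
  split_ifs with h
  · subst h
    rcases Nat.eq_zero_or_pos a with rfl | h0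
    · simp [momentSeq]
    rw [hX.integral_d_pow hp j k (by omega), ← Complex.ofReal_pow (bParam n p), bParam_sq hp hpn,
      ← two_mul, pow_mul, div_pow, Real.sq_sqrt hp.le, one_pow]
    have hp' : (p : ℂ) ≠ 0 := by exact_mod_cast hp.ne'
    have hn' : (n : ℂ) ≠ 0 := by exact_mod_cast hn
    interval_cases a
    · simp [momentSeq]
      field_simp
    · simp [momentSeq]
      field_simp
      ring
  · rw [mul_zero]

end Ensemble

/-! ### The integrand of the dual integral -/

lemma det_blockA (z₁ z₂ : ℂ) (Q : Matrix (Fin 2) (Fin 2) ℂ) :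
    (blockA z₁ z₂ Q).det = Q.det * star Q.det + z₁ * z₂ * star z₁ * star z₂
      + z₂ * star z₂ * (Q 0 0 * star (Q 0 0)) + z₂ * star z₁ * (Q 0 1 * star (Q 0 1))
      + z₁ * star z₂ * (Q 1 0 * star (Q 1 0)) + z₁ * star z₁ * (Q 1 1 * star (Q 1 1)) := by
  have h : (blockA z₁ z₂ Q).submatrix finSumFinEquiv.symm finSumFinEquiv.symm =
      !![-z₁, 0, Q 0 0, Q 0 1; 0, -z₂, Q 1 0, Q 1 1;
        -star (Q 0 0), -star (Q 1 0), -star z₁, 0; -star (Q 0 1), -star (Q 1 1), 0, -star z₂] := by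
    ext i j
    have e0 : (finSumFinEquiv (m := 2) (n := 2)).symm 0 = Sum.inl 0 := rfl
    have e1 : (finSumFinEquiv (m := 2) (n := 2)).symm 1 = Sum.inl 1 := rfl
    have e2 : (finSumFinEquiv (m := 2) (n := 2)).symm 2 = Sum.inr 0 := rfl
    have e3 : (finSumFinEquiv (m := 2) (n := 2)).symm 3 = Sum.inr 1 := rfl
    fin_cases i <;> fin_cases j <;> simp [blockA, e0, e1, e2, e3]
  rw [← Matrix.det_submatrix_equiv_self finSumFinEquiv.symm, h]
  simp [Matrix.det_succ_row_zero, Fin.sum_univ_succ, Fin.succAbove]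
  ring

lemma hFun_eq_dualTop (b : ℝ) (z₁ z₂ : ℂ) (x : (Fin 2 → Fin 2 → ℂ) × ℂ) :
    hFun b z₁ z₂ (Matrix.of x.1) x.2 =
      dualTop b (shifts z₁ z₂) (dualPt x) (fun i => star (dualPt x i)) := by
  have hv : ((‖x.2‖ ^ 2 : ℝ) : ℂ) = x.2 * star x.2 := by
    rw [Complex.star_def, Complex.mul_conj, Complex.normSq_eq_norm_sq]
  rw [hFun, hv, det_blockA, Matrix.det_conjTranspose, Matrix.det_fin_two]
  simp only [dualTop, shifts, dualPt, Matrix.of_apply, star_sub, star_mul']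
  simp
  ring

lemma trace_eq_sum (Q : Matrix (Fin 2) (Fin 2) ℂ) :
    (Qᴴ * Q).trace = ((∑ s, ∑ t, ‖Q s t‖ ^ 2 : ℝ) : ℂ) := by
  have h : ∀ q : ℂ, star q * q = ((‖q‖ ^ 2 : ℝ) : ℂ) := fun q => by
    rw [mul_comm, Complex.star_def, Complex.mul_conj, Complex.normSq_eq_norm_sq]
  simp only [Matrix.trace, Matrix.diag_apply, Matrix.mul_apply, Matrix.conjTranspose_apply, h]
  rw [Finset.sum_comm]
  push_cast
  rfl

/-- Off the zero set of `h` the branch of the logarithm disappears from the integrand. -/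
lemma exp_fHat (b : ℝ) (z₁ z₂ : ℂ) (x : (Fin 2 → Fin 2 → ℂ) × ℂ)
    (hx : hFun b z₁ z₂ (Matrix.of x.1) x.2 ≠ 0) :
    Complex.exp ((n : ℂ) * fHat b z₁ z₂ (Matrix.of x.1) x.2) =
      dualTop b (shifts z₁ z₂) (dualPt x) (fun i => star (dualPt x i)) ^ n * dualWeight n x := by
  rw [fHat, trace_eq_sum, mul_add, Complex.exp_add, Complex.exp_nat_mul (Complex.log _),
    Complex.exp_log hx, mul_comm, hFun_eq_dualTop, dualWeight]
  congr 1
  simp only [← Complex.ofReal_prod, ← Real.exp_sum]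
  rw [Fintype.sum_option, Fintype.sum_prod_type, ← Complex.ofReal_natCast, ← Complex.ofReal_neg,
    ← Complex.ofReal_sub, ← Complex.ofReal_mul, ← Complex.ofReal_exp]
  congr 2
  simp only [dualPt, ← Finset.mul_sum, Matrix.of_apply]
  ring

/-! ### The zero set of `h` is a null set -/

lemma ae_quartic_ne_zero (c₀ c₁ c₂ c₃ : ℂ) :
    ∀ᵐ t : ℝ, (t : ℂ) ^ 4 + c₃ * t ^ 3 + c₂ * t ^ 2 + c₁ * t + c₀ ≠ 0 := by
  let P : Polynomial ℂ := Polynomial.X ^ 4 + Polynomial.C c₃ * Polynomial.X ^ 3 +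
    Polynomial.C c₂ * Polynomial.X ^ 2 + Polynomial.C c₁ * Polynomial.X + Polynomial.C c₀
  have hP : P ≠ 0 := by
    intro h
    have := congrArg (fun R => Polynomial.coeff R 4) h
    simp [P] at this
  have hfin : {t : ℝ | (t : ℂ) ^ 4 + c₃ * t ^ 3 + c₂ * t ^ 2 + c₁ * t + c₀ = 0}.Finite := by
    refine ((P.roots.toFinset.finite_toSet).preimage
      (Complex.ofReal_injective.injOn)).subset fun t ht => ?_
    simp only [Set.mem_preimage, Finset.mem_coe, Multiset.mem_toFinset]
    rw [Polynomial.mem_roots hP]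
    simpa [P, Polynomial.IsRoot] using ht
  exact measure_mono_null (fun t ht => by simpa using ht) (hfin.measure_zero volume)

lemma continuous_hFun (b : ℝ) (z₁ z₂ : ℂ) :
    Continuous fun x : (Fin 2 → Fin 2 → ℂ) × ℂ => hFun b z₁ z₂ (Matrix.of x.1) x.2 := by
  simp only [hFun_eq_dualTop, dualTop, dualPt]
  fun_prop

/-- On every translate of the line spanned by `Q = 1, v = 0`, the function `h` is a quartic
polynomial with leading coefficient one, so that it vanishes only on a null set. -/
lemma ae_hFun_ne_zero (b : ℝ) (z₁ z₂ : ℂ) :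
    ∀ᵐ x : (Fin 2 → Fin 2 → ℂ) × ℂ, hFun b z₁ z₂ (Matrix.of x.1) x.2 ≠ 0 := by
  have : (volume : Measure (Fin 2 → Fin 2 → ℂ)).IsAddHaarMeasure := Measure.pi.isAddHaarMeasure _
  have : (volume : Measure ((Fin 2 → Fin 2 → ℂ) × ℂ)).IsAddHaarMeasure :=
    Measure.prod.instIsAddHaarMeasure _ _
  let u : (Fin 2 → Fin 2 → ℂ) × ℂ := (fun s t => if s = t then 1 else 0, 0)
  refine ae_mem_of_ae_add_linearMap_mem (LinearMap.toSpanSingleton ℝ _ u) volume volume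
    (s := {x | hFun b z₁ z₂ (Matrix.of x.1) x.2 ≠ 0})
    ((isOpen_ne.preimage (continuous_hFun b z₁ z₂)).measurableSet) fun x => ?_
  let ζ := shifts z₁ z₂
  let q := dualPt x
  let r := fun i => star (dualPt x i)
  let a₁ := q (some (0, 0)) + q (some (1, 1))
  let a₀ := q (some (0, 0)) * q (some (1, 1)) - q (some (0, 1)) * q (some (1, 0)) + b * q none
  let b₁ := r (some (0, 0)) + r (some (1, 1))
  let b₀ := r (some (0, 0)) * r (some (1, 1)) - r (some (0, 1)) * r (some (1, 0)) + b * r none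
  filter_upwards [ae_quartic_ne_zero
    (a₀ * b₀ + ζ 0 * ζ 1 * ζ 2 * ζ 3 + ζ 1 * ζ 3 * (q (some (0, 0)) * r (some (0, 0)))
      + ζ 1 * ζ 2 * (q (some (0, 1)) * r (some (0, 1)))
      + ζ 0 * ζ 3 * (q (some (1, 0)) * r (some (1, 0)))
      + ζ 0 * ζ 2 * (q (some (1, 1)) * r (some (1, 1))))
    (a₀ * b₁ + a₁ * b₀ + ζ 1 * ζ 3 * (q (some (0, 0)) + r (some (0, 0)))
      + ζ 0 * ζ 2 * (q (some (1, 1)) + r (some (1, 1))))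
    (a₀ + b₀ + a₁ * b₁ + ζ 1 * ζ 3 + ζ 0 * ζ 2) (a₁ + b₁)] with t ht
  change hFun b z₁ z₂ (Matrix.of (x + t • u).1) (x + t • u).2 ≠ 0
  rw [hFun_eq_dualTop]
  convert ht using 1
  simp [dualTop, a₁, a₀, b₁, b₀, q, r, dualPt, u, ζ]
  ring

end SparseCharPoly

/-- The integral is with respect to Lebesgue measure on the entries of `Q` and on `v`
(`ℂ` with its area measure). -/
theorem proposition2p1 {Ω : Type*} [MeasurableSpace Ω] (μ : Measure Ω) [IsProbabilityMeasure μ]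
    (n : ℕ) (p : ℝ) (hp : 0 < p) (hpn : p ≤ n)
    (d : Fin n → Fin n → Ω → ℝ) (w : Fin n → Fin n → Ω → ℂ)
    (hX : SparseCharPoly.IsSparseEnsemble μ n p d w) (z₁ z₂ : ℂ) :
    Integrable
        (fun ω => SparseCharPoly.charPolyProd (SparseCharPoly.sparseMatrix d w ω) ![z₁, z₂]) μ ∧
      Integrable (fun x : (Fin 2 → Fin 2 → ℂ) × ℂ =>
        Complex.exp ((n : ℂ) *
          SparseCharPoly.fHat (SparseCharPoly.bParam n p) z₁ z₂ (Matrix.of x.1) x.2)) volume ∧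
      SparseCharPoly.corrFun μ (SparseCharPoly.sparseMatrix d w) ![z₁, z₂] =
        ((n : ℂ) / (Real.pi : ℂ)) ^ 5 *
          ∫ x : (Fin 2 → Fin 2 → ℂ) × ℂ,
            Complex.exp ((n : ℂ) *
              SparseCharPoly.fHat (SparseCharPoly.bParam n p) z₁ z₂ (Matrix.of x.1) x.2) := by
  open SparseCharPoly in
  have hn : (0 : ℝ) < n := hp.trans_le hpn
  obtain ⟨hint, hcorr⟩ := corrFun_eq_berezin (x := fun j k ω => (d j k ω : ℂ) * w j k ω)
    hX.iIndepFun_entries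
    (fun j k => (Complex.measurable_ofReal.comp (hX.measurable_d j k)).mul (hX.measurable_w j k))
    (hX.memLp_entry hp) (hX.integral_entry hp hpn) z₁ z₂
  obtain ⟨hdual, hval⟩ := reproducing hn (n + 1) (dualVec n (bParam n p : ℂ))
    (fun i => dualVec_pow_eq_zero _ i (n + 1) n.lt_succ_self)
    ((berezin n).comp (centerVal n).toLinearMap)
    (∏ j, rowPoly (bParam n p : ℂ) (shifts z₁ z₂) j)
  simp only [LinearMap.comp_apply, AlgHom.toLinearMap_apply, berezin_dual] at hdual hval
  have hae : (fun x : (Fin 2 → Fin 2 → ℂ) × ℂ =>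
      Complex.exp ((n : ℂ) * fHat (bParam n p) z₁ z₂ (Matrix.of x.1) x.2)) =ᵐ[volume]
      fun x => dualTop (bParam n p) (shifts z₁ z₂) (dualPt x) (fun i => star (dualPt x i)) ^ n *
        dualWeight n x := by
    filter_upwards [ae_hFun_ne_zero (bParam n p) z₁ z₂] with x hx
    exact exp_fHat _ _ _ x hx
  refine ⟨hint, hdual.congr hae.symm, ?_⟩
  rw [integral_congr_ae hae, hval]
  refine hcorr.trans ?_
  have hn' : (n : ℂ) ≠ 0 := by exact_mod_cast hn.ne'
  have hpi : (Real.pi : ℂ) ≠ 0 := by exact_mod_cast Real.pi_ne_zero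
  rw [← mul_assoc, ← mul_pow, Complex.ofReal_natCast, div_mul_div_cancel₀ hpi, div_self hn',
    one_pow, one_mul]

end
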